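/- Let $\nu\in\mathbb C$, and let $P_\nu$ be the Legendre function of the first kind, $P_\nu(z)={}_2F_1(-\nu,\nu+1;1;\tfrac{1-z}{2})$, considered for $z>0$ (on and off the cut; continued analytically for large $z$). For functions $f$ on $(0,\infty)$ the zero-order-of-smoothness Buschman–Erdélyi operators are $$({}_1S_{0+}^{\nu}f)(x)=\frac{d}{dx}\int_0^x P_\nu\!\left(\tfrac xt\right)f(t)\,dt,\qquad ({}_1P_{0+}^{\nu}f)(x)=\int_0^x P_\nu\!\left(\tfrac tx\right)f'(t)\,dt,$$ $$({}_1P_{-}^{\nu}f)(x)=\int_x^\infty P_\nu\!\left(\tfrac tx\right)(-f'(t))\,dt,\qquad ({}_1S_{-}^{\nu}f)(x)=-\frac{d}{dx}\int_x^\infty P_\nu\!\left(\tfrac xt\right)f(t)\,dt.$$ The domain of ${}_1S_{0+}^\nu$ and of ${}_1S_-^\nu$ consists of the $f$ for which the integral converges absolutely for all $x>0$. The domain of ${}_1P_{0+}^\nu$ (of ${}_1P_-^\nu$) consists of the locally absolutely continuous $f$ for which the integral converges absolutely and $P_\nu(t/x)f(t)\to0$ as $t\to0+$ (as $t\to\infty$),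 for all $x>0$. Write $M[f](s)=\int_0^\infty x^{s-1}f(x)\,dx$ (absolutely convergent integral) and $(k*f)(x)=\int_0^\infty k(x/y)f(y)\,\frac{dy}{y}$. Each of these operators $A$ is a Mellin convolution with a kernel $K_A=\delta_1+k_A$, where $\delta_1$ is the unit mass at $1$ and $$k_{{}_1S_{0+}^\nu}(u)=P_\nu'(u)\mathbf 1_{u>1},\quad k_{{}_1P_{0+}^\nu}(u)=-\tfrac1uP_\nu'(\tfrac1u)\mathbf 1_{u>1},\quad k_{{}_1P_-^\nu}(u)=\tfrac1uP_\nu'(\tfrac1u)\mathbf 1_{0<u<1},\quad k_{{}_1S_-^\nu}(u)=-P_\nu'(u)\mathbf 1_{0<u<1}.$$ Precisely: let $H_A$ be the half-plane given for $A$ below and $s\in H_A$. Then the Mellin transform $m_A(s)=M[K_A](s)=1+M[k_A](s)$ converges absolutely, and for every $f$ in the domain of $A$ whose Mellin transform converges absolutely at $s$: the integral $(k_A*f)(x)$ converges absolutely for all $x>0$; $Af=f+k_A*f$ almost everywhere on $(0,\infty)$ (for ${}_1S_{0+}^\nu$, ${}_1S_-^\nu$ the derivative in the definition exists almost everywhere);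 $M[Af](s)$ converges absolutely; and $$M[Af](s)=m_A(s)\,M[f](s).$$ The multipliers are, with $1/\Gamma=0$ at the poles of $\Gamma$, $$m_{{}_1S_{0+}^{\nu}}(s)=\frac{\Gamma(-\frac s2+\frac\nu2+1)\,\Gamma(-\frac s2-\frac\nu2+\frac12)}{\Gamma(\frac12-\frac s2)\,\Gamma(1-\frac s2)}=\frac{2^{-s}}{\sqrt\pi}\,\frac{\Gamma(-\frac s2-\frac\nu2+\frac12)\,\Gamma(-\frac s2+\frac\nu2+1)}{\Gamma(1-s)},\quad \operatorname{Re}s<\min(2+\operatorname{Re}\nu,\,1-\operatorname{Re}\nu);$$ $$m_{{}_1P_{0+}^{\nu}}(s)=\frac{\Gamma(\frac12-\frac s2)\,\Gamma(1-\frac s2)}{\Gamma(-\frac s2+\frac\nu2+1)\,\Gamma(-\frac s2-\frac\nu2+\frac12)},\quad \operatorname{Re}s<1;$$ $$m_{{}_1P_{-}^{\nu}}(s)=\frac{\Gamma(\frac s2+\frac\nu2+\frac12)\,\Gamma(\frac s2-\frac\nu2)}{\Gamma(\frac s2)\,\Gamma(\frac s2+\frac12)},\quad \operatorname{Re}s>\max(\operatorname{Re}\nu,\,-1-\operatorname{Re}\nu);$$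 $$m_{{}_1S_{-}^{\nu}}(s)=\frac{\Gamma(\frac s2)\,\Gamma(\frac s2+\frac12)}{\Gamma(\frac s2+\frac\nu2+\frac12)\,\Gamma(\frac s2-\frac\nu2)},\quad \operatorname{Re}s>0.$$ Moreover $$m_{{}_1P_{0+}^\nu}(s)=\frac1{m_{{}_1S_{0+}^\nu}(s)},\qquad m_{{}_1P_-^\nu}(s)=\frac1{m_{{}_1S_-^\nu}(s)},\qquad m_{{}_1P_-^\nu}(s)=m_{{}_1S_{0+}^\nu}(1-s),\qquad m_{{}_1P_{0+}^\nu}(s)=m_{{}_1S_-^\nu}(1-s)$$ for all $s$ for which the points concerned lie in the respective half-planes (in the first two, the denominators do not vanish there; in the last two, $1-s$ lies in the half-plane of the right-hand side whenever $s$ lies in that of the left-hand side), and these relations hold on all of $\mathbb C$ for the meromorphic continuations given by the gamma ratios. -/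

import Mathlib

open Set Filter Topology MeasureTheory

noncomputable section

namespace BuschmanErdelyi

/-- The Legendre function of the first kind `P_ν(z) = ₂F₁(-ν, ν+1; 1; (1-z)/2)` of complex degree
`ν`, for real `z > 0`. It is written in the form
`((1+z)/2)^ν ₂F₁(-ν, -ν; 1; (z-1)/(z+1))` (Pfaff's transformation), because for every `z > 0` the
last argument lies in `(-1, 1)`, where the hypergeometric series converges; so the same formula
gives the function on the cut (`0 < z < 1`) and off the cut (`1 ≤ z`). -/
def legendreP (ν : ℂ) (z : ℝ) : ℂ :=
  (((1 + z) / 2 : ℝ) : ℂ) ^ ν * ordinaryHypergeometric (-ν) (-ν) (1 : ℂ) (((z - 1) / (z + 1) : ℝ) : ℂ)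

/-! ### The four operators -/

/-- `₁S_{0+}^ν f (x) = d/dx ∫_0^x P_ν(x/t) f(t) dt`. -/
def opSzero (ν : ℂ) (f : ℝ → ℂ) (x : ℝ) : ℂ :=
  deriv (fun z : ℝ => ∫ t in Ioc 0 z, legendreP ν (z / t) * f t) x

/-- `₁P_{0+}^ν f (x) = ∫_0^x P_ν(t/x) f'(t) dt`. -/
def opPzero (ν : ℂ) (f : ℝ → ℂ) (x : ℝ) : ℂ :=
  ∫ t in Ioc 0 x, legendreP ν (t / x) * deriv f t

/-- `₁P_{-}^ν f (x) = ∫_x^∞ P_ν(t/x) (-f'(t)) dt`. -/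
def opPminus (ν : ℂ) (f : ℝ → ℂ) (x : ℝ) : ℂ :=
  ∫ t in Ioi x, legendreP ν (t / x) * (-deriv f t)

/-- `₁S_{-}^ν f (x) = -d/dx ∫_x^∞ P_ν(x/t) f(t) dt`. -/
def opSminus (ν : ℂ) (f : ℝ → ℂ) (x : ℝ) : ℂ :=
  -deriv (fun z : ℝ => ∫ t in Ioi z, legendreP ν (z / t) * f t) x

/-! ### Their domains -/

/-- `f` is locally absolutely continuous on `(0, ∞)`. -/
def LocallyAC (f : ℝ → ℂ) : Prop :=
  ∀ a b : ℝ, 0 < a → a < b → AbsolutelyContinuousOnInterval f a b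

/-- The integral in `₁S_{0+}^ν f (x)` converges absolutely for every `x > 0`. -/
def domSzero (ν : ℂ) : Set (ℝ → ℂ) :=
  {f | ∀ x : ℝ, 0 < x → IntegrableOn (fun t => legendreP ν (x / t) * f t) (Ioc 0 x)}

/-- `f` is locally absolutely continuous, the integral in `₁P_{0+}^ν f (x)` converges absolutely
and the boundary term `P_ν(t/x) f(t)` vanishes as `t → 0+`, for every `x > 0`. -/
def domPzero (ν : ℂ) : Set (ℝ → ℂ) :=
  {f | LocallyAC f ∧ ∀ x : ℝ, 0 < x →
    IntegrableOn (fun t => legendreP ν (t / x) * deriv f t) (Ioc 0 x) ∧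
    Tendsto (fun t => legendreP ν (t / x) * f t) (𝓝[>] 0) (𝓝 0)}

/-- `f` is locally absolutely continuous, the integral in `₁P_{-}^ν f (x)` converges absolutely
and the boundary term `P_ν(t/x) f(t)` vanishes as `t → ∞`, for every `x > 0`. -/
def domPminus (ν : ℂ) : Set (ℝ → ℂ) :=
  {f | LocallyAC f ∧ ∀ x : ℝ, 0 < x →
    IntegrableOn (fun t => legendreP ν (t / x) * (-deriv f t)) (Ioi x) ∧
    Tendsto (fun t => legendreP ν (t / x) * f t) atTop (𝓝 0)}

/-- The integral in `₁S_{-}^ν f (x)` converges absolutely for every `x > 0`. -/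
def domSminus (ν : ℂ) : Set (ℝ → ℂ) :=
  {f | ∀ x : ℝ, 0 < x → IntegrableOn (fun t => legendreP ν (x / t) * f t) (Ioi x)}

/-! ### Mellin convolutions

The kernel of each operator is `K = δ₁ + k`, where `δ₁` is the unit point mass at `1` (the unit of
the Mellin convolution, with Mellin transform `1`) and `k` is a function on `(0, ∞)`. -/

/-- `(k * f)(x) = ∫_0^∞ k(x/y) f(y) dy/y`. -/
def mellinConv (k f : ℝ → ℂ) (x : ℝ) : ℂ :=
  ∫ y in Ioi (0 : ℝ), k (x / y) * f y / (y : ℂ)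

/-- The Mellin transform of `δ₁ + k`. -/
def multiplier (k : ℝ → ℂ) (s : ℂ) : ℂ := 1 + mellin k s

/-- The operator `A`, with domain `D`, is the Mellin convolution with the kernel `δ₁ + k`, whose
Mellin transform converges in `H`; and for `s ∈ H` it acts under the Mellin transform as the
multiplication by the Mellin transform of its kernel. -/
def ActsAsMellinConvolution (A : (ℝ → ℂ) → ℝ → ℂ) (D : Set (ℝ → ℂ)) (k : ℝ → ℂ) (H : Set ℂ) :
    Prop :=
  ∀ s ∈ H, MellinConvergent k s ∧
    ∀ f ∈ D, MellinConvergent f s →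
      (∀ x : ℝ, 0 < x → IntegrableOn (fun y : ℝ => k (x / y) * f y / (y : ℂ)) (Ioi 0)) ∧
      (∀ᵐ x ∂(volume.restrict (Ioi (0 : ℝ))), A f x = f x + mellinConv k f x) ∧
      MellinConvergent (A f) s ∧
      mellin (A f) s = multiplier k s * mellin f s

/-- The function part of the kernel of `₁S_{0+}^ν`. -/
def kerSzero (ν : ℂ) (u : ℝ) : ℂ := if 1 < u then deriv (legendreP ν) u else 0

/-- The function part of the kernel of `₁P_{0+}^ν`. -/
def kerPzero (ν : ℂ) (u : ℝ) : ℂ := if 1 < u then -(deriv (legendreP ν) (1 / u) / (u : ℂ)) else 0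

/-- The function part of the kernel of `₁P_{-}^ν`. -/
def kerPminus (ν : ℂ) (u : ℝ) : ℂ :=
  if 0 < u ∧ u < 1 then deriv (legendreP ν) (1 / u) / (u : ℂ) else 0

/-- The function part of the kernel of `₁S_{-}^ν`. -/
def kerSminus (ν : ℂ) (u : ℝ) : ℂ :=
  if 0 < u ∧ u < 1 then -deriv (legendreP ν) u else 0

/-! ### The half-planes -/

def halfSzero (ν : ℂ) : Set ℂ := {s | s.re < min (2 + ν.re) (1 - ν.re)}

def halfPzero : Set ℂ := {s | s.re < 1}

def halfPminus (ν : ℂ) : Set ℂ := {s | max ν.re (-1 - ν.re) < s.re}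

def halfSminus : Set ℂ := {s | 0 < s.re}

/-! ### The gamma ratios

`Complex.Gamma` and the division have the value `0` at a pole and at a zero denominator, so a
ratio is `0`, as it should be, where only its denominator has a pole. -/

def gammaSzero (ν s : ℂ) : ℂ :=
  Complex.Gamma (-s / 2 + ν / 2 + 1) * Complex.Gamma (-s / 2 - ν / 2 + 1 / 2) /
    (Complex.Gamma (1 / 2 - s / 2) * Complex.Gamma (1 - s / 2))

def gammaPzero (ν s : ℂ) : ℂ :=
  Complex.Gamma (1 / 2 - s / 2) * Complex.Gamma (1 - s / 2) /
    (Complex.Gamma (-s / 2 + ν / 2 + 1) * Complex.Gamma (-s / 2 - ν / 2 + 1 / 2))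

def gammaPminus (ν s : ℂ) : ℂ :=
  Complex.Gamma (s / 2 + ν / 2 + 1 / 2) * Complex.Gamma (s / 2 - ν / 2) /
    (Complex.Gamma (s / 2) * Complex.Gamma (s / 2 + 1 / 2))

def gammaSminus (ν s : ℂ) : ℂ :=
  Complex.Gamma (s / 2) * Complex.Gamma (s / 2 + 1 / 2) /
    (Complex.Gamma (s / 2 + ν / 2 + 1 / 2) * Complex.Gamma (s / 2 - ν / 2))

end BuschmanErdelyi

end

/-!
In Pfaff's form the series of `P_ν` and of its derivative have coefficients comparable to binomial
coefficients, so `P_ν(u) = O(u ^ r)` and `P_ν'(u) = O(u ^ (r - 1))` at infinity for every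
`r > max (Re ν) (-1 - Re ν)`, while Gronwall's inequality for the Legendre equation bounds `P_ν`
and `P_ν'` near `0`. This makes the kernels absolutely Mellin integrable on the half-planes. Since
`P_ν(1) = 1`, the function `P_ν` is there a primitive of `δ₁ + k` up to signs and a reflection: for
the operators `₁S` Fubini's theorem shows that the integral is a primitive of `f + k * f`, and for
the operators `₁P` the same identity is an integration by parts.

For the multiplier, the Legendre equation makes
`(s(s+1) u^(s-1) - (s-ν)(s+ν+1) u^(s+1)) P_ν'(u)` an exact derivative, which gives a recurrence
relating `m(s)` to `m(s+2)`. For a kernel supported on `(0, 1)` one has `m(s+2n) → 1`, and the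
recurrence together with this limit identifies `m` with a gamma ratio through Euler's product. The
remaining two multipliers follow by the reflection `u ↦ 1/u`, which turns `s` into `1 - s`.
-/

namespace BuschmanErdelyi

open Asymptotics

/-! ### Binomial coefficients with a real upper parameter -/

theorem multichoose_eq_ascPochhammer_div (p : ℝ) (n : ℕ) :
    Ring.multichoose p n = (ascPochhammer ℝ n).eval p / n.factorial := by
  rw [eq_div_iff (by positivity), mul_comm, ← nsmul_eq_mul,
    Ring.factorial_nsmul_multichoose_eq_ascPochhammer, Polynomial.ascPochhammer_smeval_eq_eval]

theorem multichoose_pos {p : ℝ} (hp : 0 < p) (n : ℕ) : 0 < Ring.multichoose p n := by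
  rw [multichoose_eq_ascPochhammer_div]
  exact div_pos (ascPochhammer_pos n p hp) (by positivity)

theorem succ_mul_multichoose_succ (p : ℝ) (n : ℕ) :
    (n + 1) * Ring.multichoose p (n + 1) = (p + n) * Ring.multichoose p n := by
  simp only [multichoose_eq_ascPochhammer_div, ascPochhammer_succ_eval, Nat.factorial_succ]
  push_cast
  field_simp

theorem succ_mul_multichoose_succ' (p : ℝ) (n : ℕ) :
    (n + 1) * Ring.multichoose p (n + 1) = p * Ring.multichoose (p + 1) n := by
  simp only [multichoose_eq_ascPochhammer_div, ascPochhammer_succ_left, Nat.factorial_succ,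
    Polynomial.eval_mul, Polynomial.eval_X, Polynomial.eval_comp, Polynomial.eval_add,
    Polynomial.eval_one]
  push_cast
  field_simp

theorem hasSum_multichoose (p : ℝ) {x : ℝ} (hx : |x| < 1) :
    HasSum (fun n ↦ Ring.multichoose p n * x ^ n) ((1 - x) ^ (-p)) := by
  have h := (Real.one_div_one_sub_rpow_hasFPowerSeriesOnBall_zero p).hasSum (y := x)
    (by simpa [enorm_eq_nnnorm, ← NNReal.coe_lt_one] using hx)
  simp only [zero_add, FormalMultilinearSeries.ofScalars_apply_eq, smul_eq_mul, one_div,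
    ← Ring.multichoose_eq] at h
  rwa [← Real.rpow_neg (by linarith [(abs_lt.1 hx).2])] at h

theorem isBigO_of_eventually_norm_succ_mul_le {E : Type*} [SeminormedAddCommGroup E] {u : ℕ → E}
    {v : ℕ → ℝ} (hv : ∀ᶠ n in atTop, 0 < v n)
    (h : ∀ᶠ n in atTop, ‖u (n + 1)‖ * v n ≤ ‖u n‖ * v (n + 1)) : u =O[atTop] v := by
  obtain ⟨N, hN⟩ := eventually_atTop.1 (hv.and h)
  have hanti : AntitoneOn (fun n ↦ ‖u n‖ / v n) (Ici N) := by
    refine antitoneOn_of_succ_le ordConnected_Ici fun n _ hn _ ↦ ?_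
    rw [Nat.succ_eq_succ, div_le_div_iff₀ (hN _ (hn.trans n.le_succ)).1 (hN n hn).1]
    exact (hN n hn).2
  refine IsBigO.of_bound (‖u N‖ / v N) (eventually_atTop.2 ⟨N, fun n hn ↦ ?_⟩)
  rw [Real.norm_of_nonneg (hN n hn).1.le, ← div_le_iff₀ (hN n hn).1]
  exact hanti self_mem_Ici hn hn

/-! ### Power series on the unit interval -/

/-- The sum of the power series with complex coefficients `a`, as a function of a real variable. -/
noncomputable def powerSum (a : ℕ → ℂ) (x : ℝ) : ℂ := ∑' n, a n * (x : ℂ) ^ n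

/-- The coefficients of the termwise derivative of the power series with coefficients `a`. -/
def derivCoeff (a : ℕ → ℂ) (n : ℕ) : ℂ := (n + 1) * a (n + 1)

theorem norm_derivCoeff (a : ℕ → ℂ) (n : ℕ) : ‖derivCoeff a n‖ = (n + 1) * ‖a (n + 1)‖ := by
  rw [derivCoeff, norm_mul, ← Nat.cast_succ, Complex.norm_natCast, Nat.cast_succ]

theorem isBigO_derivCoeff {a : ℕ → ℂ} {p : ℝ} (ha : a =O[atTop] Ring.multichoose p) :
    derivCoeff a =O[atTop] Ring.multichoose (p + 1) := by
  obtain ⟨C, hC⟩ := (ha.comp_tendsto (tendsto_add_atTop_nat 1)).bound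
  refine IsBigO.of_bound (C * |p|) (hC.mono fun n hn ↦ ?_)
  calc ‖derivCoeff a n‖ = (n + 1) * ‖a (n + 1)‖ := norm_derivCoeff a n
    _ ≤ (n + 1) * (C * ‖Ring.multichoose p (n + 1)‖) := by gcongr; exact hn
    _ = C * ‖(n + 1) * Ring.multichoose p (n + 1)‖ := by
      rw [norm_mul, Real.norm_of_nonneg (by positivity : (0 : ℝ) ≤ n + 1)]; ring
    _ = C * |p| * ‖Ring.multichoose (p + 1) n‖ := by
      rw [succ_mul_multichoose_succ', norm_mul, Real.norm_eq_abs p, mul_assoc]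

theorem summable_of_isBigO_multichoose {a : ℕ → ℂ} {p x : ℝ} (ha : a =O[atTop] Ring.multichoose p)
    (hx : |x| < 1) : Summable fun n ↦ a n * (x : ℂ) ^ n := by
  refine summable_of_isBigO_nat (hasSum_multichoose p hx).summable (ha.mul ?_)
  exact IsBigO.of_bound 1 (Eventually.of_forall fun n ↦ by simp)

theorem exists_norm_powerSum_le {a : ℕ → ℂ} {p : ℝ} (hp : 0 < p)
    (ha : a =O[atTop] Ring.multichoose p) :
    ∃ C, 0 < C ∧ ∀ x : ℝ, 0 ≤ x → x < 1 → ‖powerSum a x‖ ≤ C * (1 - x) ^ (-p) := by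
  obtain ⟨C, hC0, hC⟩ := bound_of_isBigO_nat_atTop ha
  refine ⟨C, hC0, fun x hx0 hx1 ↦ tsum_of_norm_bounded
    ((hasSum_multichoose p (by rwa [abs_of_nonneg hx0])).mul_left C) fun n ↦ ?_⟩
  have hpos := multichoose_pos hp n
  have han := hC hpos.ne'
  rw [Real.norm_of_nonneg hpos.le] at han
  rw [norm_mul, norm_pow, Complex.norm_real, Real.norm_of_nonneg hx0, ← mul_assoc]
  gcongr

theorem hasDerivAt_powerSum {a : ℕ → ℂ} {r x : ℝ} (hxr : |x| < r)
    (ha : Summable fun n ↦ derivCoeff a n * (r : ℂ) ^ n) :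
    HasDerivAt (powerSum a) (powerSum (derivCoeff a) x) x := by
  have hr : 0 < r := (abs_nonneg x).trans_lt hxr
  have hterm (n : ℕ) (y : ℝ) :
      HasDerivAt (fun y : ℝ ↦ a (n + 1) * (y : ℂ) ^ (n + 1)) (derivCoeff a n * (y : ℂ) ^ n) y := by
    convert! (hasDerivAt_id y).ofReal_comp.pow (n + 1) |>.const_mul (a (n + 1)) using 1
    simp only [derivCoeff, id, Nat.cast_add, Nat.cast_one, add_tsub_cancel_right,
      Complex.ofReal_one, mul_one]
    ring
  have hbound (n : ℕ) (y : ℝ) (hy : y ∈ Ioo (-r) r) :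
      ‖derivCoeff a n * (y : ℂ) ^ n‖ ≤ ‖derivCoeff a n * (r : ℂ) ^ n‖ := by
    simp only [norm_mul, norm_pow, Complex.norm_real, Real.norm_eq_abs, abs_of_pos hr]
    gcongr
    exact (abs_lt.2 hy).le
  have h0 : (0 : ℝ) ∈ Ioo (-r) r := ⟨neg_lt_zero.2 hr, hr⟩
  have hsum0 : Summable fun n ↦ a (n + 1) * ((0 : ℝ) : ℂ) ^ (n + 1) := by
    simp [summable_zero]
  have hsplit : (fun y ↦ a 0 + ∑' n, a (n + 1) * (y : ℂ) ^ (n + 1)) =ᶠ[𝓝 x] powerSum a := by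
    filter_upwards [isOpen_Ioo.mem_nhds (abs_lt.1 hxr)] with y hy
    have hs := summable_of_summable_hasDerivAt_of_isPreconnected ha.norm isOpen_Ioo
      isPreconnected_Ioo (fun n y _ ↦ hterm n y) hbound h0 hsum0 hy
    rw [powerSum, tsum_eq_zero_add' (f := fun n ↦ a n * (y : ℂ) ^ n) hs, pow_zero, mul_one]
  exact ((hasDerivAt_tsum_of_isPreconnected ha.norm isOpen_Ioo isPreconnected_Ioo
    (fun n y _ ↦ hterm n y) hbound h0 hsum0 (abs_lt.1 hxr)).const_add (a 0)).congr_of_eventuallyEq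
      hsplit.symm

theorem hasDerivAt_powerSum_of_isBigO {a : ℕ → ℂ} {p x : ℝ} (ha : a =O[atTop] Ring.multichoose p)
    (hx : |x| < 1) : HasDerivAt (powerSum a) (powerSum (derivCoeff a) x) x := by
  obtain ⟨r, hxr, hr1⟩ := exists_between hx
  have hr : |r| < 1 := by rwa [abs_of_pos ((abs_nonneg x).trans_lt hxr)]
  exact hasDerivAt_powerSum hxr (summable_of_isBigO_multichoose (isBigO_derivCoeff ha) hr)

theorem hasSum_natCast_mul_coeff {a : ℕ → ℂ} {x : ℝ} {S : ℂ}
    (h : HasSum (fun n ↦ derivCoeff a n * (x : ℂ) ^ n) S) :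
    HasSum (fun n : ℕ ↦ n * a n * (x : ℂ) ^ n) (x * S) := by
  rw [← hasSum_nat_add_iff' 1]
  simp only [Finset.range_one, Finset.sum_singleton, Nat.cast_zero, zero_mul, sub_zero]
  convert! h.mul_left (x : ℂ) using 2 with n
  rw [derivCoeff]
  push_cast
  ring

/-! ### The hypergeometric series in Pfaff's form of the Legendre function -/

/-- The coefficients of `₂F₁(-ν, -ν; 1; x)`. -/
noncomputable def hypCoeff (ν : ℂ) (n : ℕ) : ℂ :=
  ((ascPochhammer ℂ n).eval (-ν) / n.factorial) ^ 2

theorem ordinaryHypergeometric_eq_powerSum (ν : ℂ) (x : ℝ) :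
    ordinaryHypergeometric (-ν) (-ν) (1 : ℂ) (x : ℂ) = powerSum (hypCoeff ν) x := by
  rw [ordinaryHypergeometric_eq_tsum, powerSum]
  refine tsum_congr fun n ↦ ?_
  rw [ascPochhammer_eval_one, hypCoeff, smul_eq_mul]
  field_simp

theorem hypCoeff_succ (ν : ℂ) (n : ℕ) :
    (n + 1 : ℂ) ^ 2 * hypCoeff ν (n + 1) = (n - ν) ^ 2 * hypCoeff ν n := by
  have h : (n + 1 : ℂ) ≠ 0 := Nat.cast_add_one_ne_zero n
  rw [hypCoeff, hypCoeff, ascPochhammer_succ_eval, Nat.factorial_succ]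
  push_cast
  field_simp
  ring

theorem norm_hypCoeff_succ (ν : ℂ) (n : ℕ) :
    ((n : ℝ) + 1) ^ 2 * ‖hypCoeff ν (n + 1)‖ =
      (n ^ 2 - 2 * n * ν.re + ‖ν‖ ^ 2) * ‖hypCoeff ν n‖ := by
  have h1 : ‖(n + 1 : ℂ)‖ = n + 1 := by
    rw [← Nat.cast_succ, Complex.norm_natCast, Nat.cast_succ]
  have h2 : ‖(n - ν : ℂ)‖ ^ 2 = n ^ 2 - 2 * n * ν.re + ‖ν‖ ^ 2 := by
    simp only [Complex.sq_norm, Complex.normSq_apply, Complex.sub_re, Complex.sub_im,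
      Complex.natCast_re, Complex.natCast_im]
    ring
  have h := congrArg norm (hypCoeff_succ ν n)
  rwa [norm_mul, norm_mul, norm_pow, norm_pow, h1, h2] at h

theorem isBigO_hypCoeff (ν : ℂ) {p : ℝ} (hp : 0 < p) (hνp : -1 - 2 * ν.re < p) :
    hypCoeff ν =O[atTop] Ring.multichoose p := by
  refine isBigO_of_eventually_norm_succ_mul_le (Eventually.of_forall (multichoose_pos hp)) ?_
  have hd : 0 < p + 1 + 2 * ν.re := by linarith
  filter_upwards [tendsto_natCast_atTop_atTop.eventually_ge_atTop (‖ν‖ ^ 2 / (p + 1 + 2 * ν.re))]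
    with n hn
  rw [div_le_iff₀ hd] at hn
  have hratio : (n : ℝ) ^ 2 - 2 * n * ν.re + ‖ν‖ ^ 2 ≤ (n + 1) * (p + n) := by linarith
  have hb := (multichoose_pos hp n).le
  refine le_of_mul_le_mul_left ?_ (by positivity : (0 : ℝ) < (n + 1) ^ 2)
  calc ((n : ℝ) + 1) ^ 2 * (‖hypCoeff ν (n + 1)‖ * Ring.multichoose p n)
      = (n ^ 2 - 2 * n * ν.re + ‖ν‖ ^ 2) * (‖hypCoeff ν n‖ * Ring.multichoose p n) := by
        rw [← mul_assoc, norm_hypCoeff_succ, mul_assoc]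
    _ ≤ (n + 1) * (p + n) * (‖hypCoeff ν n‖ * Ring.multichoose p n) := by gcongr
    _ = (n + 1) ^ 2 * (‖hypCoeff ν n‖ * Ring.multichoose p (n + 1)) := by
      linear_combination (-(n + 1) * ‖hypCoeff ν n‖) * succ_mul_multichoose_succ p n

theorem exists_isBigO_hypCoeff (ν : ℂ) : ∃ p : ℝ, hypCoeff ν =O[atTop] Ring.multichoose p :=
  ⟨|(-1 - 2 * ν.re)| + 1, isBigO_hypCoeff ν (by positivity)
    (by linarith [le_abs_self (-1 - 2 * ν.re)])⟩

theorem hasDerivAt_powerSum_hypCoeff (ν : ℂ) {x : ℝ} (hx : |x| < 1) :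
    HasDerivAt (powerSum (hypCoeff ν)) (powerSum (derivCoeff (hypCoeff ν)) x) x := by
  obtain ⟨p, hp⟩ := exists_isBigO_hypCoeff ν
  exact hasDerivAt_powerSum_of_isBigO hp hx

theorem hasDerivAt_powerSum_derivCoeff_hypCoeff (ν : ℂ) {x : ℝ} (hx : |x| < 1) :
    HasDerivAt (powerSum (derivCoeff (hypCoeff ν)))
      (powerSum (derivCoeff (derivCoeff (hypCoeff ν))) x) x := by
  obtain ⟨p, hp⟩ := exists_isBigO_hypCoeff ν
  exact hasDerivAt_powerSum_of_isBigO (isBigO_derivCoeff hp) hx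

theorem powerSum_hypCoeff_ode (ν : ℂ) {x : ℝ} (hx : |x| < 1) :
    x * (1 - x) * powerSum (derivCoeff (derivCoeff (hypCoeff ν))) x +
      (1 - (1 - 2 * ν) * x) * powerSum (derivCoeff (hypCoeff ν)) x -
        ν ^ 2 * powerSum (hypCoeff ν) x = 0 := by
  set a := hypCoeff ν
  obtain ⟨p, hp⟩ := exists_isBigO_hypCoeff ν
  have hF := (summable_of_isBigO_multichoose hp hx).hasSum
  have hF' := (summable_of_isBigO_multichoose (isBigO_derivCoeff hp) hx).hasSum
  have hF'' :=
    (summable_of_isBigO_multichoose (isBigO_derivCoeff (isBigO_derivCoeff hp)) hx).hasSum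
  have hxF' := hasSum_natCast_mul_coeff hF'
  have hxF'' := hasSum_natCast_mul_coeff hF''
  have hxxF'' := hasSum_natCast_mul_coeff (a := fun n ↦ (n - 1) * a n)
    (hxF''.congr_fun fun n ↦ by simp only [derivCoeff]; push_cast; ring)
  have h := (((hxF''.sub hxxF'').add hF').sub (hxF'.mul_left (1 - 2 * ν))).sub
    (hF.mul_left (ν ^ 2))
  have hzero := h.unique (hasSum_zero.congr_fun fun n ↦ ?_)
  · rw [← hzero]
    simp only [powerSum]
    ring
  · simp only [derivCoeff]
    linear_combination (x : ℂ) ^ n * hypCoeff_succ ν n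

/-! ### The Legendre function and its differential equation -/

theorem legendreP_eq (ν : ℂ) (z : ℝ) :
    legendreP ν z = (((1 + z) / 2 : ℝ) : ℂ) ^ ν * powerSum (hypCoeff ν) ((z - 1) / (z + 1)) := by
  rw [legendreP, ordinaryHypergeometric_eq_powerSum]

theorem legendreP_one (ν : ℂ) : legendreP ν 1 = 1 := by
  simp [legendreP, ordinaryHypergeometric_zero]

theorem abs_sub_one_div_add_one_lt_one {z : ℝ} (hz : 0 < z) : |(z - 1) / (z + 1)| < 1 := by
  rw [abs_lt, lt_div_iff₀ (by linarith), div_lt_iff₀ (by linarith)]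
  constructor <;> linarith

theorem hasDerivAt_comp_sub_one_div_add_one {F : ℝ → ℂ} {F' : ℂ} {z : ℝ} (hz : 0 < z)
    (hF : HasDerivAt F F' ((z - 1) / (z + 1))) :
    HasDerivAt (fun z : ℝ ↦ F ((z - 1) / (z + 1))) (2 / (z + 1) ^ 2 * F') z := by
  have harg : HasDerivAt (fun z : ℝ ↦ (z - 1) / (z + 1)) (2 / (z + 1) ^ 2) z := by
    convert! ((hasDerivAt_id z).sub_const 1).div ((hasDerivAt_id z).add_const 1)
      (by simp only [id]; positivity) using 1
    simp only [id]
    ring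
  convert! hF.scomp z harg using 1
  rw [Complex.real_smul]
  push_cast
  rfl

theorem hasDerivAt_one_add_div_two_cpow {z : ℝ} (hz : -1 < z) (a : ℂ) :
    HasDerivAt (fun z : ℝ ↦ (((1 + z) / 2 : ℝ) : ℂ) ^ a)
      (a / 2 * (((1 + z) / 2 : ℝ) : ℂ) ^ (a - 1)) z := by
  have hlin : HasDerivAt (fun z : ℝ ↦ (((1 + z) / 2 : ℝ) : ℂ)) (((1 / 2 : ℝ)) : ℂ) z :=
    (((hasDerivAt_id z).const_add 1).div_const 2).ofReal_comp
  have hslit : (((1 + z) / 2 : ℝ) : ℂ) ∈ Complex.slitPlane :=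
    Complex.ofReal_mem_slitPlane.2 (by linarith)
  convert! ((hasDerivAt_id (((1 + z) / 2 : ℝ) : ℂ)).cpow_const (c := a) hslit).scomp z hlin using 1
  rw [smul_eq_mul, id_eq]
  push_cast
  ring

theorem ofReal_one_add_div_two_ne_zero {z : ℝ} (hz : 0 < z) : (((1 + z) / 2 : ℝ) : ℂ) ≠ 0 :=
  Complex.ofReal_ne_zero.2 (by positivity)

theorem ofReal_add_one_ne_zero {z : ℝ} (hz : 0 < z) : (z : ℂ) + 1 ≠ 0 := by
  exact_mod_cast (by positivity : z + 1 ≠ 0)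

theorem hasDerivAt_legendreP (ν : ℂ) {z : ℝ} (hz : 0 < z) :
    HasDerivAt (legendreP ν) ((((1 + z) / 2 : ℝ) : ℂ) ^ (ν - 1) / 2 *
      (ν * powerSum (hypCoeff ν) ((z - 1) / (z + 1)) +
        2 / (z + 1) * powerSum (derivCoeff (hypCoeff ν)) ((z - 1) / (z + 1)))) z := by
  rw [funext (legendreP_eq ν)]
  have hz1 := ofReal_add_one_ne_zero hz
  convert! (hasDerivAt_one_add_div_two_cpow (by linarith) ν).mul
    (hasDerivAt_comp_sub_one_div_add_one hz
      (hasDerivAt_powerSum_hypCoeff ν (abs_sub_one_div_add_one_lt_one hz))) using 1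
  rw [Complex.cpow_sub _ _ (ofReal_one_add_div_two_ne_zero hz), Complex.cpow_one]
  push_cast
  rw [add_comm (1 : ℂ)]
  field_simp

theorem deriv_legendreP (ν : ℂ) {z : ℝ} (hz : 0 < z) :
    deriv (legendreP ν) z = (((1 + z) / 2 : ℝ) : ℂ) ^ (ν - 1) / 2 *
      (ν * powerSum (hypCoeff ν) ((z - 1) / (z + 1)) +
        2 / (z + 1) * powerSum (derivCoeff (hypCoeff ν)) ((z - 1) / (z + 1))) :=
  (hasDerivAt_legendreP ν hz).deriv

theorem differentiableAt_legendreP (ν : ℂ) {z : ℝ} (hz : 0 < z) :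
    DifferentiableAt ℝ (legendreP ν) z :=
  (hasDerivAt_legendreP ν hz).differentiableAt

theorem continuousOn_legendreP (ν : ℂ) : ContinuousOn (legendreP ν) (Ioi 0) :=
  fun _ hz ↦ (differentiableAt_legendreP ν hz).continuousAt.continuousWithinAt

theorem hasDerivAt_deriv_legendreP (ν : ℂ) {z : ℝ} (hz : 0 < z) :
    HasDerivAt (deriv (legendreP ν)) ((((1 + z) / 2 : ℝ) : ℂ) ^ (ν - 2) / 4 *
      ((ν - 1) * ν * powerSum (hypCoeff ν) ((z - 1) / (z + 1)) +
        4 * (ν - 1) / (z + 1) * powerSum (derivCoeff (hypCoeff ν)) ((z - 1) / (z + 1)) +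
        4 / (z + 1) ^ 2 *
          powerSum (derivCoeff (derivCoeff (hypCoeff ν))) ((z - 1) / (z + 1)))) z := by
  have hz1 := ofReal_add_one_ne_zero hz
  have hw := abs_sub_one_div_add_one_lt_one hz
  have hF := hasDerivAt_comp_sub_one_div_add_one hz (hasDerivAt_powerSum_hypCoeff ν hw)
  have hF' := hasDerivAt_comp_sub_one_div_add_one hz
    (hasDerivAt_powerSum_derivCoeff_hypCoeff ν hw)
  have hinv : HasDerivAt (fun z : ℝ ↦ (2 : ℂ) / (z + 1)) (-2 / (z + 1) ^ 2) z := by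
    convert! (hasDerivAt_const z (2 : ℂ)).div ((hasDerivAt_id z).ofReal_comp.add_const 1) hz1
      using 1
    simp
  have h := ((hasDerivAt_one_add_div_two_cpow (by linarith) (ν - 1)).div_const 2).mul
    ((hF.const_mul ν).add (hinv.mul hF'))
  refine (h.congr_of_eventuallyEq ?_).congr_deriv ?_
  · filter_upwards [lt_mem_nhds hz] with y hy using deriv_legendreP ν hy
  · have hhalf := ofReal_one_add_div_two_ne_zero hz
    have hpow : (((1 + z) / 2 : ℝ) : ℂ) ^ (ν - 1) =
        (((1 + z) / 2 : ℝ) : ℂ) ^ (ν - 2) * (((1 + z) / 2 : ℝ) : ℂ) := by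
      rw [show ν - 1 = ν - 2 + 1 by ring, Complex.cpow_add _ _ hhalf, Complex.cpow_one]
    simp only [Pi.add_apply, Pi.mul_apply]
    rw [hpow, show ν - 1 - 1 = ν - 2 by ring]
    push_cast
    rw [add_comm (1 : ℂ)]
    field_simp
    ring

theorem continuousOn_deriv_legendreP (ν : ℂ) : ContinuousOn (deriv (legendreP ν)) (Ioi 0) :=
  fun _ hz ↦ (hasDerivAt_deriv_legendreP ν hz).continuousAt.continuousWithinAt

theorem legendre_ode (ν : ℂ) {z : ℝ} (hz : 0 < z) :
    HasDerivAt (fun z : ℝ ↦ (1 - (z : ℂ) ^ 2) * deriv (legendreP ν) z)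
      (-(ν * (ν + 1)) * legendreP ν z) z := by
  have hsq : HasDerivAt (fun z : ℝ ↦ 1 - (z : ℂ) ^ 2) (-(2 * (z : ℂ))) z := by
    convert! ((hasDerivAt_id z).ofReal_comp.pow 2).const_sub 1 using 1
    simp
  refine (hsq.mul (hasDerivAt_deriv_legendreP ν hz)).congr_deriv ?_
  have hhyp := powerSum_hypCoeff_ode ν (abs_sub_one_div_add_one_lt_one hz)
  have hz1 := ofReal_add_one_ne_zero hz
  have hhalf := ofReal_one_add_div_two_ne_zero hz
  have hpow1 : (((1 + z) / 2 : ℝ) : ℂ) ^ (ν - 1) =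
      (((1 + z) / 2 : ℝ) : ℂ) ^ (ν - 2) * (((1 + z) / 2 : ℝ) : ℂ) := by
    rw [show ν - 1 = ν - 2 + 1 by ring, Complex.cpow_add _ _ hhalf, Complex.cpow_one]
  have hpow2 : (((1 + z) / 2 : ℝ) : ℂ) ^ ν =
      (((1 + z) / 2 : ℝ) : ℂ) ^ (ν - 2) * (((1 + z) / 2 : ℝ) : ℂ) ^ 2 := by
    conv_lhs => rw [show ν = ν - 2 + 2 by ring]
    rw [Complex.cpow_add _ _ hhalf, Complex.cpow_ofNat]
  rw [deriv_legendreP ν hz, legendreP_eq, hpow1, hpow2]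
  generalize powerSum (derivCoeff (derivCoeff (hypCoeff ν))) ((z - 1) / (z + 1)) = F2 at *
  generalize powerSum (derivCoeff (hypCoeff ν)) ((z - 1) / (z + 1)) = F1 at *
  generalize powerSum (hypCoeff ν) ((z - 1) / (z + 1)) = F0 at *
  generalize (((1 + z) / 2 : ℝ) : ℂ) ^ (ν - 2) = E
  push_cast at hhyp ⊢
  rw [add_comm (1 : ℂ)]
  field_simp at hhyp ⊢
  linear_combination -(8 * E * (z + 1)) * hhyp

/-! ### Growth of the Legendre function -/

theorem exists_one_add_div_two_rpow_le (a : ℝ) :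
    ∃ K, 0 ≤ K ∧ ∀ z : ℝ, 1 ≤ z → ((1 + z) / 2) ^ a ≤ K * z ^ a := by
  refine ⟨max 1 ((1 / 2) ^ a), by positivity, fun z hz ↦ ?_⟩
  rcases le_total 0 a with ha | ha
  · calc ((1 + z) / 2) ^ a ≤ z ^ a := Real.rpow_le_rpow (by linarith) (by linarith) ha
      _ ≤ max 1 ((1 / 2) ^ a) * z ^ a := le_mul_of_one_le_left (by positivity) (le_max_left _ _)
  · calc ((1 + z) / 2) ^ a ≤ (1 / 2 * z) ^ a :=
          Real.rpow_le_rpow_of_nonpos (by linarith) (by linarith) ha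
      _ = (1 / 2) ^ a * z ^ a := Real.mul_rpow (by norm_num) (by linarith)
      _ ≤ max 1 ((1 / 2) ^ a) * z ^ a := by gcongr; exact le_max_right _ _

theorem exists_norm_powerSum_comp_le {a : ℕ → ℂ} {p : ℝ} (hp : 0 < p)
    (ha : a =O[atTop] Ring.multichoose p) :
    ∃ C, 0 < C ∧ ∀ z : ℝ, 1 ≤ z →
      ‖powerSum a ((z - 1) / (z + 1))‖ ≤ C * ((1 + z) / 2) ^ p := by
  obtain ⟨C, hC0, hC⟩ := exists_norm_powerSum_le hp ha
  refine ⟨C, hC0, fun z hz ↦ ?_⟩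
  have hz0 : 0 < z := by linarith
  have h := hC _ (div_nonneg (by linarith) (by linarith))
    (abs_lt.1 (abs_sub_one_div_add_one_lt_one hz0)).2
  rwa [show 1 - (z - 1) / (z + 1) = ((1 + z) / 2)⁻¹ by field_simp; ring,
    Real.inv_rpow (by positivity), ← Real.rpow_neg (by positivity), neg_neg] at h

theorem exists_norm_legendreP_le_rpow (ν : ℂ) {r : ℝ} (h1 : ν.re < r) (h2 : -1 - ν.re < r) :
    ∃ C, ∀ z : ℝ, 1 ≤ z → ‖legendreP ν z‖ ≤ C * z ^ r := by
  have hp : 0 < r - ν.re := by linarith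
  obtain ⟨C, hC0, hC⟩ := exists_norm_powerSum_comp_le hp (isBigO_hypCoeff ν hp (by linarith))
  obtain ⟨K, -, hK⟩ := exists_one_add_div_two_rpow_le r
  refine ⟨C * K, fun z hz ↦ ?_⟩
  have hc : 0 < (1 + z) / 2 := by linarith
  rw [legendreP_eq, norm_mul, Complex.norm_cpow_eq_rpow_re_of_pos hc]
  calc ((1 + z) / 2) ^ ν.re * ‖powerSum (hypCoeff ν) ((z - 1) / (z + 1))‖
      ≤ ((1 + z) / 2) ^ ν.re * (C * ((1 + z) / 2) ^ (r - ν.re)) := by gcongr; exact hC z hz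
    _ = C * ((1 + z) / 2) ^ r := by rw [mul_left_comm, ← Real.rpow_add hc, add_sub_cancel]
    _ ≤ C * (K * z ^ r) := by gcongr; exact hK z hz
    _ = C * K * z ^ r := by ring

theorem exists_norm_deriv_legendreP_le_rpow (ν : ℂ) {r : ℝ} (h1 : ν.re < r)
    (h2 : -1 - ν.re < r) :
    ∃ C, ∀ z : ℝ, 1 ≤ z → ‖deriv (legendreP ν) z‖ ≤ C * z ^ (r - 1) := by
  have hp : 0 < r - ν.re := by linarith
  have hO := isBigO_hypCoeff ν hp (by linarith)
  obtain ⟨C, hC0, hC⟩ := exists_norm_powerSum_comp_le hp hO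
  obtain ⟨D, hD0, hD⟩ := exists_norm_powerSum_comp_le (by linarith) (isBigO_derivCoeff hO)
  obtain ⟨K, -, hK⟩ := exists_one_add_div_two_rpow_le (r - 1)
  refine ⟨(‖ν‖ * C + D) / 2 * K, fun z hz ↦ ?_⟩
  have hc : 0 < (1 + z) / 2 := by linarith
  have hnorm : ‖(2 : ℂ) / (z + 1)‖ = ((1 + z) / 2)⁻¹ := by
    rw [norm_div, ← Complex.ofReal_one, ← Complex.ofReal_add, Complex.norm_real,
      Real.norm_of_nonneg (by linarith), Complex.norm_ofNat, inv_div, add_comm]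
  rw [deriv_legendreP ν (by linarith), norm_mul, norm_div,
    Complex.norm_cpow_eq_rpow_re_of_pos hc, Complex.norm_ofNat, Complex.sub_re, Complex.one_re]
  calc _ ≤ ((1 + z) / 2) ^ (ν.re - 1) / 2 * (‖ν‖ * (C * ((1 + z) / 2) ^ (r - ν.re)) +
        ((1 + z) / 2)⁻¹ * (D * ((1 + z) / 2) ^ (r - ν.re + 1))) := by
        grw [norm_add_le, norm_mul, norm_mul, hnorm, hC z hz, hD z hz]
    _ = (‖ν‖ * C + D) / 2 * ((1 + z) / 2) ^ (r - 1) := by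
      rw [Real.rpow_add_one hc.ne', show r - 1 = (ν.re - 1) + (r - ν.re) by ring,
        Real.rpow_add hc]
      field_simp
    _ ≤ (‖ν‖ * C + D) / 2 * (K * z ^ (r - 1)) := by gcongr; exact hK z hz
    _ = (‖ν‖ * C + D) / 2 * K * z ^ (r - 1) := by ring

/-! ### Boundedness of the Legendre function near the origin -/

theorem norm_le_mul_exp_of_norm_deriv_le {E : Type*} [NormedAddCommGroup E] [NormedSpace ℝ E]
    {Y Y' : ℝ → E} {a b K : ℝ} (hab : a ≤ b) (hY : ∀ t ∈ Icc a b, HasDerivAt Y (Y' t) t)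
    (hK : ∀ t ∈ Icc a b, ‖Y' t‖ ≤ K * ‖Y t‖) : ‖Y a‖ ≤ ‖Y b‖ * Real.exp (K * (b - a)) := by
  have hmem {t : ℝ} (ht : t ∈ Icc 0 (b - a)) : b - t ∈ Icc a b :=
    ⟨by linarith [ht.2], by linarith [ht.1]⟩
  have hder (t : ℝ) (ht : t ∈ Icc 0 (b - a)) :
      HasDerivAt (fun t ↦ Y (b - t)) (-Y' (b - t)) t := by
    convert! (hY _ (hmem ht)).scomp t ((hasDerivAt_id t).const_sub b) using 1
    simp
  have h := norm_le_gronwallBound_of_norm_deriv_right_le (δ := ‖Y b‖) (K := K) (ε := 0)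
    (fun t ht ↦ (hder t ht).continuousAt.continuousWithinAt)
    (fun t ht ↦ (hder t (Ico_subset_Icc_self ht)).hasDerivWithinAt) (by simp)
    (fun t ht ↦ by simpa using hK _ (hmem (Ico_subset_Icc_self ht)))
    (b - a) ⟨sub_nonneg.2 hab, le_rfl⟩
  rwa [gronwallBound_ε0, sub_sub_cancel, sub_zero] at h

theorem norm_deriv_legendreP_le_two_mul (ν : ℂ) {z : ℝ} (h0 : 0 < z) (h1 : z ≤ 1 / 2) :
    ‖deriv (legendreP ν) z‖ ≤ 2 * ‖(1 - (z : ℂ) ^ 2) * deriv (legendreP ν) z‖ := by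
  have hfactor : ‖1 - (z : ℂ) ^ 2‖ = 1 - z ^ 2 := by
    rw [← Complex.ofReal_one, ← Complex.ofReal_pow, ← Complex.ofReal_sub, Complex.norm_real,
      Real.norm_of_nonneg (by nlinarith)]
  have hhalf : 1 ≤ 2 * (1 - z ^ 2) := by nlinarith
  rw [norm_mul, hfactor, ← mul_assoc]
  exact le_mul_of_one_le_left (norm_nonneg _) hhalf

theorem exists_norm_legendreP_le_of_le_half (ν : ℂ) :
    ∃ C, ∀ z : ℝ, 0 < z → z ≤ 1 / 2 →
      ‖legendreP ν z‖ ≤ C ∧ ‖deriv (legendreP ν) z‖ ≤ C := by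
  set Y : ℝ → ℂ × ℂ := fun z ↦ (legendreP ν z, (1 - (z : ℂ) ^ 2) * deriv (legendreP ν) z)
  set K : ℝ := 2 + ‖ν * (ν + 1)‖
  have hder' {z : ℝ} (h0 : 0 < z) (h1 : z ≤ 1 / 2) : ‖deriv (legendreP ν) z‖ ≤ 2 * ‖Y z‖ :=
    (norm_deriv_legendreP_le_two_mul ν h0 h1).trans (by gcongr; exact norm_snd_le (Y z))
  have hY {z : ℝ} (h0 : 0 < z) : HasDerivAt Y
      (deriv (legendreP ν) z, -(ν * (ν + 1)) * legendreP ν z) z :=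
    (differentiableAt_legendreP ν h0).hasDerivAt.prodMk (legendre_ode ν h0)
  have hYK {z : ℝ} (h0 : 0 < z) (h1 : z ≤ 1 / 2) :
      ‖(deriv (legendreP ν) z, -(ν * (ν + 1)) * legendreP ν z)‖ ≤ K * ‖Y z‖ := by
    rw [Prod.norm_mk, add_mul]
    refine max_le ((hder' h0 h1).trans (le_add_of_nonneg_right (by positivity))) ?_
    rw [norm_mul, norm_neg]
    exact (mul_le_mul_of_nonneg_left (norm_fst_le (Y z)) (norm_nonneg _)).trans
      (le_add_of_nonneg_left (by positivity))
  set B : ℝ := ‖Y (1 / 2)‖ * Real.exp K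
  have hbound {z : ℝ} (h0 : 0 < z) (h1 : z ≤ 1 / 2) : ‖Y z‖ ≤ B := by
    refine (norm_le_mul_exp_of_norm_deriv_le h1 (fun t ht ↦ hY (h0.trans_le ht.1))
      fun t ht ↦ hYK (h0.trans_le ht.1) ht.2).trans ?_
    exact mul_le_mul_of_nonneg_left (Real.exp_le_exp.2
      (mul_le_of_le_one_right (by positivity) (by linarith))) (norm_nonneg _)
  refine ⟨2 * B, fun z h0 h1 ↦ ⟨?_, ?_⟩⟩
  · linarith [norm_fst_le (Y z), hbound h0 h1, norm_nonneg (Y z)]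
  · linarith [hder' h0 h1, hbound h0 h1]

theorem exists_norm_legendreP_le_of_le_one (ν : ℂ) :
    ∃ C, ∀ z : ℝ, 0 < z → z ≤ 1 → ‖legendreP ν z‖ ≤ C ∧ ‖deriv (legendreP ν) z‖ ≤ C := by
  obtain ⟨C₀, h₀⟩ := exists_norm_legendreP_le_of_le_half ν
  have hsub : Icc (1 / 2 : ℝ) 1 ⊆ Ioi 0 := fun z hz ↦ lt_of_lt_of_le (by norm_num) hz.1
  obtain ⟨C₁, h₁⟩ := isCompact_Icc.exists_bound_of_continuousOn
    ((continuousOn_legendreP ν).mono hsub)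
  obtain ⟨C₂, h₂⟩ := isCompact_Icc.exists_bound_of_continuousOn
    ((continuousOn_deriv_legendreP ν).mono hsub)
  refine ⟨max C₀ (max C₁ C₂), fun z hz0 hz1 ↦ ?_⟩
  rcases le_total z (1 / 2) with hz | hz
  · exact (h₀ z hz0 hz).imp le_max_of_le_left le_max_of_le_left
  · exact ⟨le_max_of_le_right (le_max_of_le_left (h₁ z ⟨hz, hz1⟩)),
      le_max_of_le_right (le_max_of_le_right (h₂ z ⟨hz, hz1⟩))⟩

/-! ### Mellin convolutions -/

theorem norm_ofReal_cpow_sub_one {t : ℝ} (ht : 0 < t) (s : ℂ) :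
    ‖(t : ℂ) ^ (s - 1)‖ = t ^ (s.re - 1) := by
  rw [Complex.norm_cpow_eq_rpow_re_of_pos ht, Complex.sub_re, Complex.one_re]

theorem ofReal_cpow_one_sub_mul_cpow_sub_one_smul {t : ℝ} (ht : 0 < t) (s z : ℂ) :
    (t : ℂ) ^ (1 - s) * ((t : ℂ) ^ (s - 1) • z) = z := by
  rw [smul_eq_mul, ← mul_assoc, ← Complex.cpow_add _ _ (Complex.ofReal_ne_zero.2 ht.ne'),
    sub_add_sub_cancel', sub_self, Complex.cpow_zero, one_mul]

theorem aestronglyMeasurable_of_mellinConvergent {f : ℝ → ℂ} {s : ℂ} (hf : MellinConvergent f s) :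
    AEStronglyMeasurable f (volume.restrict (Ioi 0)) := by
  have hpow : Measurable fun t : ℝ ↦ (t : ℂ) ^ (1 - s) := by fun_prop
  refine (hpow.aestronglyMeasurable.mul hf.aestronglyMeasurable).congr ?_
  filter_upwards [ae_restrict_mem measurableSet_Ioi] with t ht
    using ofReal_cpow_one_sub_mul_cpow_sub_one_smul ht s (f t)

theorem integrableOn_Icc_of_mellinConvergent {f : ℝ → ℂ} {s : ℂ} (hf : MellinConvergent f s)
    {a b : ℝ} (ha : 0 < a) : IntegrableOn f (Icc a b) := by
  have hsub : Icc a b ⊆ Ioi 0 := fun t ht ↦ ha.trans_le ht.1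
  have hpow : ContinuousOn (fun t : ℝ ↦ (t : ℂ) ^ (1 - s)) (Icc a b) := fun t ht ↦
    (Complex.continuousAt_ofReal_cpow_const t _ (.inr (ne_of_gt (hsub ht)))).continuousWithinAt
  exact ((hf.mono_set hsub).continuousOn_mul hpow isCompact_Icc).congr_fun
    (fun t ht ↦ ofReal_cpow_one_sub_mul_cpow_sub_one_smul (hsub ht) s (f t)) measurableSet_Icc

theorem integrableOn_rpow_mul_norm {f : ℝ → ℂ} {s : ℂ} (hf : MellinConvergent f s) :
    IntegrableOn (fun y : ℝ ↦ y ^ (s.re - 1) * ‖f y‖) (Ioi 0) := by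
  refine hf.norm.congr ?_
  filter_upwards [ae_restrict_mem measurableSet_Ioi] with y hy
  rw [norm_smul, norm_ofReal_cpow_sub_one hy]

theorem mellinConvergent_comp_div {k : ℝ → ℂ} {s : ℂ} (hks : MellinConvergent k s) {y : ℝ}
    (hy : 0 < y) : MellinConvergent (fun x ↦ k (x / y)) s := by
  simpa only [div_eq_inv_mul] using (MellinConvergent.comp_mul_left (inv_pos.2 hy)).2 hks

theorem mellin_comp_div (k : ℝ → ℂ) (s : ℂ) {y : ℝ} (hy : 0 < y) :
    mellin (fun x ↦ k (x / y)) s = (y : ℂ) ^ s * mellin k s := by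
  simp only [div_eq_inv_mul]
  rw [mellin_comp_mul_left k s (inv_pos.2 hy), smul_eq_mul, Complex.ofReal_inv, Complex.cpow_neg,
    Complex.inv_cpow _ _ (by rw [Complex.arg_ofReal_of_nonneg hy.le]; exact Real.pi_pos.ne),
    inv_inv]

theorem aestronglyMeasurable_mellinConv_integrand {k f : ℝ → ℂ} {s : ℂ} (hk : Measurable k)
    (hf : MellinConvergent f s) (μ : Measure ℝ) :
    AEStronglyMeasurable (fun p : ℝ × ℝ ↦ k (p.1 / p.2) * f p.2 / (p.2 : ℂ))
      (μ.prod (volume.restrict (Ioi 0))) := by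
  have hker : Measurable fun p : ℝ × ℝ ↦ k (p.1 / p.2) :=
    hk.comp (measurable_fst.div measurable_snd)
  have hinv : Measurable fun p : ℝ × ℝ ↦ (p.2 : ℂ)⁻¹ := by fun_prop
  simp only [div_eq_mul_inv _ ((_ : ℝ) : ℂ)]
  exact (hker.aestronglyMeasurable.mul
    (aestronglyMeasurable_of_mellinConvergent hf).comp_snd).mul hinv.aestronglyMeasurable

theorem norm_mellinConv_integrand_le {k : ℝ → ℂ} {C r : ℝ}
    (hC : ∀ u : ℝ, 0 < u → ‖k u‖ ≤ C * u ^ (-r)) (f : ℝ → ℂ) {x y : ℝ} (hx : 0 < x) (hy : 0 < y) :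
    ‖k (x / y) * f y / (y : ℂ)‖ ≤ C * x ^ (-r) * (y ^ (r - 1) * ‖f y‖) := by
  rw [norm_div, norm_mul, Complex.norm_real, Real.norm_of_nonneg hy.le]
  calc ‖k (x / y)‖ * ‖f y‖ / y ≤ C * (x / y) ^ (-r) * ‖f y‖ / y := by
        gcongr
        exact hC _ (div_pos hx hy)
    _ = C * x ^ (-r) * (y ^ (r - 1) * ‖f y‖) := by
      rw [Real.div_rpow hx.le hy.le, Real.rpow_neg hy.le, Real.rpow_sub hy, Real.rpow_one]
      field_simp

theorem integrable_mellinConv_prod {k f : ℝ → ℂ} {s : ℂ} (hk : Measurable k)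
    (hks : MellinConvergent k s) (hf : MellinConvergent f s) :
    Integrable (fun p : ℝ × ℝ ↦ (p.1 : ℂ) ^ (s - 1) * (k (p.1 / p.2) * f p.2 / (p.2 : ℂ)))
      ((volume.restrict (Ioi 0)).prod (volume.restrict (Ioi 0))) := by
  have hpow : Measurable fun p : ℝ × ℝ ↦ (p.1 : ℂ) ^ (s - 1) := by fun_prop
  have hmeas : AEStronglyMeasurable
      (fun p : ℝ × ℝ ↦ (p.1 : ℂ) ^ (s - 1) * (k (p.1 / p.2) * f p.2 / (p.2 : ℂ)))
      ((volume.restrict (Ioi 0)).prod (volume.restrict (Ioi 0))) :=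
    hpow.aestronglyMeasurable.mul (aestronglyMeasurable_mellinConv_integrand hk hf _)
  refine (integrable_prod_iff' hmeas).2 ⟨?_, ?_⟩
  · filter_upwards [ae_restrict_mem measurableSet_Ioi] with y hy
    refine ((mellinConvergent_comp_div hks hy).mul_const (f y / y)).congr (ae_of_all _ fun x ↦ ?_)
    simp only [smul_eq_mul, mul_div_assoc, mul_assoc]
  · refine ((integrableOn_rpow_mul_norm hf).const_mul
      (∫ u in Ioi (0 : ℝ), u ^ (s.re - 1) * ‖k u‖)).congr ?_
    filter_upwards [ae_restrict_mem measurableSet_Ioi] with y hy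
    have hy' : (0 : ℝ) < y := hy
    have hscale := integral_comp_mul_left_Ioi (fun u ↦ u ^ (s.re - 1) * ‖k u‖) 0 (inv_pos.2 hy')
    rw [mul_zero, inv_inv, smul_eq_mul] at hscale
    have hnorm (x : ℝ) (hx : x ∈ Ioi 0) : ‖(x : ℂ) ^ (s - 1) * (k (x / y) * f y / (y : ℂ))‖ =
        (y⁻¹ * x) ^ (s.re - 1) * ‖k (y⁻¹ * x)‖ * (y ^ (s.re - 1) * ‖f y‖ / y) := by
      rw [norm_mul, norm_ofReal_cpow_sub_one hx, norm_div, norm_mul, Complex.norm_real,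
        Real.norm_of_nonneg hy'.le, Real.mul_rpow (inv_pos.2 hy').le (le_of_lt hx),
        Real.inv_rpow hy'.le, div_eq_inv_mul x y]
      field_simp
    rw [setIntegral_congr_fun measurableSet_Ioi hnorm, integral_mul_const, hscale]
    field_simp

theorem mellinConvergent_mellinConv {k f : ℝ → ℂ} {s : ℂ} (hk : Measurable k)
    (hks : MellinConvergent k s) (hf : MellinConvergent f s) :
    MellinConvergent (mellinConv k f) s := by
  refine (integrable_mellinConv_prod hk hks hf).integral_prod_left.congr (ae_of_all _ fun x ↦ ?_)
  simp only [smul_eq_mul, mellinConv, integral_const_mul]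

theorem mellin_mellinConv {k f : ℝ → ℂ} {s : ℂ} (hk : Measurable k)
    (hks : MellinConvergent k s) (hf : MellinConvergent f s) :
    mellin (mellinConv k f) s = mellin k s * mellin f s := by
  have hswap := integral_integral_swap (f := fun x y : ℝ ↦
    (x : ℂ) ^ (s - 1) * (k (x / y) * f y / (y : ℂ))) (integrable_mellinConv_prod hk hks hf)
  simp only [integral_const_mul] at hswap
  simp only [mellin, mellinConv, smul_eq_mul]
  rw [hswap, ← integral_const_mul]
  refine setIntegral_congr_fun measurableSet_Ioi fun y hy ↦ ?_
  have hyc : (y : ℂ) ≠ 0 := Complex.ofReal_ne_zero.2 (ne_of_gt hy)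
  have hscale := mellin_comp_div k s hy
  simp only [mellin, smul_eq_mul] at hscale
  calc ∫ x in Ioi (0 : ℝ), (x : ℂ) ^ (s - 1) * (k (x / y) * f y / (y : ℂ))
      = (∫ x in Ioi (0 : ℝ), (x : ℂ) ^ (s - 1) * k (x / y)) * (f y / y) := by
        simp only [← integral_mul_const, mul_div_assoc, mul_assoc]
    _ = _ := by
      rw [hscale, Complex.cpow_sub _ _ hyc, Complex.cpow_one]
      field_simp

/-- The kernels whose Mellin convolution with every function with absolutely convergent Mellin
transform at `s` converges absolutely at every point of `(0, ∞)`, and has an absolutely convergent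
Mellin transform at `s`. -/
structure MellinAdmissible (k : ℝ → ℂ) (s : ℂ) : Prop where
  measurable : Measurable k
  mellinConvergent : MellinConvergent k s
  exists_norm_le : ∃ C, ∀ u : ℝ, 0 < u → ‖k u‖ ≤ C * u ^ (-s.re)

theorem mellinAdmissible_of_norm_le {k : ℝ → ℂ} {s : ℂ} {a b C : ℝ} (hk : Measurable k)
    (htop : ∀ u : ℝ, 1 < u → ‖k u‖ ≤ C * u ^ (-a)) (ha : s.re < a)
    (hbot : ∀ u : ℝ, 0 < u → u ≤ 1 → ‖k u‖ ≤ C * u ^ (-b)) (hb : b < s.re) :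
    MellinAdmissible k s := by
  have hC : 0 ≤ C := by simpa using (norm_nonneg _).trans (hbot 1 one_pos le_rfl)
  have hle {u : ℝ} (hu : 0 < u) : ‖k u‖ ≤ C * (u ^ (-a) + u ^ (-b)) := by
    have hua : 0 ≤ u ^ (-a) := by positivity
    have hub : 0 ≤ u ^ (-b) := by positivity
    rcases le_or_gt u 1 with h | h
    · exact (hbot u hu h).trans (by gcongr; linarith)
    · exact (htop u h).trans (by gcongr; linarith)
  refine ⟨hk, mellinConvergent_of_isBigO_rpow (a := a) (b := b) ?_ ?_ ha ?_ hb, C, fun u hu ↦ ?_⟩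
  · have hcont : ContinuousOn (fun u : ℝ ↦ C * (u ^ (-a) + u ^ (-b))) (Ioi 0) := fun u hu ↦
      (((Real.continuousAt_rpow_const u _ (.inl (ne_of_gt hu))).add
        (Real.continuousAt_rpow_const u _ (.inl (ne_of_gt hu)))).const_mul C).continuousWithinAt
    refine (locallyIntegrableOn_iff isOpen_Ioi.isLocallyClosed).2 fun K hK hKc ↦
      ((hcont.mono hK).integrableOn_compact hKc).mono' hk.aestronglyMeasurable ?_
    filter_upwards [ae_restrict_mem hKc.measurableSet] with u hu using hle (hK hu)
  · refine IsBigO.of_bound C ?_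
    filter_upwards [eventually_gt_atTop 1] with u hu
    rw [Real.norm_of_nonneg (by positivity)]
    exact htop u hu
  · refine IsBigO.of_bound C ?_
    filter_upwards [Ioc_mem_nhdsGT one_pos] with u hu
    rw [Real.norm_of_nonneg (Real.rpow_nonneg hu.1.le _)]
    exact hbot u hu.1 hu.2
  · rcases le_or_gt u 1 with h | h
    · exact (hbot u hu h).trans (mul_le_mul_of_nonneg_left
        (Real.rpow_le_rpow_of_exponent_ge hu h (by linarith)) hC)
    · exact (htop u h).trans (mul_le_mul_of_nonneg_left
        (Real.rpow_le_rpow_of_exponent_le h.le (by linarith)) hC)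

theorem MellinAdmissible.integrableOn_mellinConv {k f : ℝ → ℂ} {s : ℂ}
    (hk : MellinAdmissible k s) (hf : MellinConvergent f s) {x : ℝ} (hx : 0 < x) :
    IntegrableOn (fun y : ℝ ↦ k (x / y) * f y / (y : ℂ)) (Ioi 0) := by
  obtain ⟨C, hC⟩ := hk.exists_norm_le
  refine ((integrableOn_rpow_mul_norm hf).const_mul (C * x ^ (-s.re))).mono' ?_ ?_
  · have hker : Measurable fun y : ℝ ↦ k (x / y) :=
      hk.measurable.comp (measurable_const.div measurable_id)
    have hinv : Measurable fun y : ℝ ↦ (y : ℂ)⁻¹ := by fun_prop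
    simp only [div_eq_mul_inv _ ((_ : ℝ) : ℂ)]
    exact (hker.aestronglyMeasurable.mul (aestronglyMeasurable_of_mellinConvergent hf)).mul
      hinv.aestronglyMeasurable
  · filter_upwards [ae_restrict_mem measurableSet_Ioi] with y hy
      using norm_mellinConv_integrand_le hC f hx hy

theorem MellinAdmissible.integrable_mellinConv_prod_Ioc {k f : ℝ → ℂ} {s : ℂ}
    (hk : MellinAdmissible k s) (hf : MellinConvergent f s) {a z : ℝ} (ha : 0 < a) :
    Integrable (fun p : ℝ × ℝ ↦ k (p.1 / p.2) * f p.2 / (p.2 : ℂ))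
      ((volume.restrict (Ioc a z)).prod (volume.restrict (Ioi 0))) := by
  obtain ⟨C, hC⟩ := hk.exists_norm_le
  have hpow : IntegrableOn (fun x : ℝ ↦ C * x ^ (-s.re)) (Ioc a z) := by
    refine (ContinuousOn.integrableOn_Icc fun x hx ↦ ?_).mono_set Ioc_subset_Icc_self
    exact ((Real.continuousAt_rpow_const x _
      (.inl (ha.trans_le hx.1).ne')).const_mul C).continuousWithinAt
  refine (hpow.mul_prod (integrableOn_rpow_mul_norm hf)).mono'
    (aestronglyMeasurable_mellinConv_integrand hk.measurable hf _) ?_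
  rw [Measure.prod_restrict]
  filter_upwards [ae_restrict_mem (measurableSet_Ioc.prod measurableSet_Ioi)] with p hp
    using norm_mellinConv_integrand_le hC f (ha.trans hp.1.1) hp.2

theorem actsAsMellinConvolution_of_ae_eq {A : (ℝ → ℂ) → ℝ → ℂ} {D : Set (ℝ → ℂ)} {k : ℝ → ℂ}
    {H : Set ℂ} (hk : ∀ s ∈ H, MellinAdmissible k s)
    (hA : ∀ s ∈ H, ∀ f ∈ D, MellinConvergent f s →
      ∀ᵐ x ∂(volume.restrict (Ioi (0 : ℝ))), A f x = f x + mellinConv k f x) :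
    ActsAsMellinConvolution A D k H := by
  refine fun s hs ↦ ⟨(hk s hs).mellinConvergent, fun f hfD hf ↦ ?_⟩
  have hAf := hA s hs f hfD hf
  have hconv := mellinConvergent_mellinConv (hk s hs).measurable (hk s hs).mellinConvergent hf
  have hsum : HasMellin (fun x ↦ f x + mellinConv k f x) s
      (mellin f s + mellin (mellinConv k f) s) := hasMellin_add hf hconv
  have hcongr : (fun x : ℝ ↦ (x : ℂ) ^ (s - 1) • (f x + mellinConv k f x)) =ᵐ[volume.restrict
      (Ioi 0)] fun x : ℝ ↦ (x : ℂ) ^ (s - 1) • A f x := by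
    filter_upwards [hAf] with x hx
    rw [hx]
  refine ⟨fun x hx ↦ (hk s hs).integrableOn_mellinConv hf hx, hAf, hsum.1.congr hcongr, ?_⟩
  rw [mellin, ← integral_congr_ae hcongr, ← mellin, hsum.2,
    mellin_mellinConv (hk s hs).measurable (hk s hs).mellinConvergent hf, multiplier, add_mul,
    one_mul]

/-! ### Transposed kernels -/

/-- The kernel `k(1/u)/u` of the transpose, with respect to `∫ f(x) g(x) dx`, of the Mellin
convolution with `k`. It carries the kernels of the operators `S` to those of the operators `P`. -/
noncomputable def transposeKernel (k : ℝ → ℂ) (u : ℝ) : ℂ := (u : ℂ)⁻¹ * k u⁻¹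

theorem transposeKernel_eq_cpow_smul (k : ℝ → ℂ) :
    transposeKernel k = fun u : ℝ ↦ (u : ℂ) ^ (-1 : ℂ) • k u⁻¹ := by
  funext u
  rw [transposeKernel, Complex.cpow_neg_one, smul_eq_mul]

theorem mellin_transposeKernel (k : ℝ → ℂ) (s : ℂ) :
    mellin (transposeKernel k) s = mellin k (1 - s) := by
  rw [transposeKernel_eq_cpow_smul, mellin_cpow_smul, mellin_comp_inv, neg_add, neg_neg,
    neg_add_eq_sub]

theorem multiplier_transposeKernel (k : ℝ → ℂ) (s : ℂ) :
    multiplier (transposeKernel k) s = multiplier k (1 - s) := by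
  rw [multiplier, multiplier, mellin_transposeKernel]

theorem MellinAdmissible.transposeKernel {k : ℝ → ℂ} {s : ℂ} (hk : MellinAdmissible k (1 - s)) :
    MellinAdmissible (transposeKernel k) s where
  measurable := (Complex.measurable_ofReal.inv).mul (hk.measurable.comp measurable_inv)
  mellinConvergent := by
    rw [transposeKernel_eq_cpow_smul, MellinConvergent.cpow_smul]
    have h := (MellinConvergent.comp_rpow (f := k) (s := s + -1) (a := -1) (by norm_num)).2
      (by simpa [div_neg, neg_add_rev, ← sub_eq_add_neg] using hk.mellinConvergent)
    simpa only [Real.rpow_neg_one] using h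
  exists_norm_le := by
    obtain ⟨C, hC⟩ := hk.exists_norm_le
    refine ⟨C, fun u hu ↦ ?_⟩
    have h := hC u⁻¹ (inv_pos.2 hu)
    rw [Real.inv_rpow hu.le, ← Real.rpow_neg hu.le, neg_neg, Complex.sub_re, Complex.one_re,
      sub_eq_neg_add, Real.rpow_add_one hu.ne'] at h
    rw [BuschmanErdelyi.transposeKernel, norm_mul, norm_inv, Complex.norm_real,
      Real.norm_of_nonneg hu.le, inv_mul_le_iff₀ hu]
    linarith

theorem kerPzero_eq_transposeKernel (ν : ℂ) : kerPzero ν = transposeKernel (kerSminus ν) := by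
  funext u
  simp only [kerPzero, transposeKernel, kerSminus, inv_lt_one_iff₀, inv_pos, one_div]
  split_ifs <;> grind

theorem kerPminus_eq_transposeKernel (ν : ℂ) : kerPminus ν = transposeKernel (kerSzero ν) := by
  funext u
  simp only [kerPminus, transposeKernel, kerSzero, one_lt_inv_iff₀, one_div]
  split_ifs <;> grind

/-! ### Admissibility of the kernels -/

theorem mellinAdmissible_kerSzero {ν s : ℂ} (hs : s ∈ halfSzero ν) :
    MellinAdmissible (kerSzero ν) s := by
  obtain ⟨h1, h2⟩ := lt_min_iff.1 (mem_ofPred.1 hs)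
  obtain ⟨r, hr1, hr2⟩ := exists_between
    (max_lt (by linarith : ν.re < 1 - s.re) (by linarith : -1 - ν.re < 1 - s.re))
  obtain ⟨C, hC⟩ := exists_norm_deriv_legendreP_le_rpow ν ((le_max_left _ _).trans_lt hr1)
    ((le_max_right _ _).trans_lt hr1)
  have hC0 : 0 ≤ C := by simpa using (norm_nonneg _).trans (hC 1 le_rfl)
  refine mellinAdmissible_of_norm_le (C := C) (a := 1 - r) (b := s.re - 1)
    (Measurable.ite measurableSet_Ioi (measurable_deriv _) measurable_const)
    (fun u hu ↦ ?_) (by linarith) (fun u hu0 hu1 ↦ ?_) (by linarith)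
  · rw [kerSzero, if_pos hu, neg_sub]
    exact hC u hu.le
  · rw [kerSzero, if_neg hu1.not_gt, norm_zero]
    positivity

theorem mellinAdmissible_kerSminus (ν : ℂ) {s : ℂ} (hs : s ∈ halfSminus) :
    MellinAdmissible (kerSminus ν) s := by
  obtain ⟨C, hC⟩ := exists_norm_legendreP_le_of_le_one ν
  have hC0 : 0 ≤ C := (norm_nonneg _).trans (hC 1 one_pos le_rfl).1
  refine mellinAdmissible_of_norm_le (C := C) (a := s.re + 1) (b := 0)
    (Measurable.ite measurableSet_Ioo (measurable_deriv _).neg measurable_const)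
    (fun u hu ↦ ?_) (by linarith) (fun u hu0 hu1 ↦ ?_) hs
  · rw [kerSminus, if_neg fun h ↦ h.2.not_gt hu, norm_zero]
    positivity
  · rw [neg_zero, Real.rpow_zero, mul_one, kerSminus]
    split_ifs
    · exact (norm_neg _).trans_le (hC u hu0 hu1).2
    · exact norm_zero.trans_le hC0

theorem one_sub_mem_halfSzero_iff {ν s : ℂ} : 1 - s ∈ halfSzero ν ↔ s ∈ halfPminus ν := by
  simp only [halfSzero, halfPminus, mem_ofPred, lt_min_iff, max_lt_iff, Complex.sub_re,
    Complex.one_re]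
  grind

theorem one_sub_mem_halfSminus_iff {s : ℂ} : 1 - s ∈ halfSminus ↔ s ∈ halfPzero := by
  simp [halfSminus, halfPzero]

theorem mellinAdmissible_kerPzero (ν : ℂ) {s : ℂ} (hs : s ∈ halfPzero) :
    MellinAdmissible (kerPzero ν) s := by
  rw [kerPzero_eq_transposeKernel]
  exact (mellinAdmissible_kerSminus ν (one_sub_mem_halfSminus_iff.2 hs)).transposeKernel

theorem mellinAdmissible_kerPminus {ν s : ℂ} (hs : s ∈ halfPminus ν) :
    MellinAdmissible (kerPminus ν) s := by
  rw [kerPminus_eq_transposeKernel]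
  exact (mellinAdmissible_kerSzero (one_sub_mem_halfSzero_iff.2 hs)).transposeKernel

/-! ### Absolutely continuous complex functions -/

theorem absolutelyContinuousOnInterval_comp {X Y : Type*} [PseudoMetricSpace X]
    [PseudoMetricSpace Y] {φ : X → Y} {K : NNReal} (hφ : LipschitzWith K φ) {f : ℝ → X} {a b : ℝ}
    (hf : AbsolutelyContinuousOnInterval f a b) :
    AbsolutelyContinuousOnInterval (fun t ↦ φ (f t)) a b := by
  refine squeeze_zero (fun E ↦ Finset.sum_nonneg fun _ _ ↦ dist_nonneg) (fun E ↦ ?_)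
    (by simpa using Tendsto.const_mul (K : ℝ) hf)
  rw [Finset.mul_sum]
  exact Finset.sum_le_sum fun i _ ↦ hφ.dist_le_mul _ _

theorem ae_hasDerivAt_deriv_of_absolutelyContinuous {f : ℝ → ℂ} {a b : ℝ}
    (hf : AbsolutelyContinuousOnInterval f a b) :
    ∀ᵐ x : ℝ, x ∈ uIoc a b → HasDerivAt f (deriv f x) x := by
  filter_upwards [hf.boundedVariationOn.ae_differentiableAt_of_mem_uIcc] with x hx hmem
  exact (hx (uIoc_subset_uIcc hmem)).hasDerivAt

theorem intervalIntegrable_and_integral_clm_deriv (L : ℂ →L[ℝ] ℝ) {f : ℝ → ℂ} {a b : ℝ}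
    (hf : AbsolutelyContinuousOnInterval f a b) :
    IntervalIntegrable (fun x ↦ L (deriv f x)) volume a b ∧
      ∫ x in a..b, L (deriv f x) = L (f b) - L (f a) := by
  have hLf := absolutelyContinuousOnInterval_comp L.lipschitz hf
  have hderiv : ∀ᵐ x : ℝ, x ∈ uIoc a b → deriv (fun t ↦ L (f t)) x = L (deriv f x) := by
    filter_upwards [ae_hasDerivAt_deriv_of_absolutelyContinuous hf] with x hx hmem
    exact (L.hasFDerivAt.comp_hasDerivAt x (hx hmem)).deriv
  exact ⟨hLf.intervalIntegrable_deriv.congr_ae ((ae_restrict_iff' measurableSet_uIoc).2 hderiv),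
    by rw [← intervalIntegral.integral_congr_ae hderiv, hLf.integral_deriv_eq_sub]⟩

theorem integral_deriv_of_absolutelyContinuous {f : ℝ → ℂ} {a b : ℝ}
    (hf : AbsolutelyContinuousOnInterval f a b) : ∫ x in a..b, deriv f x = f b - f a := by
  obtain ⟨hre, hre'⟩ := intervalIntegrable_and_integral_clm_deriv Complex.reCLM hf
  obtain ⟨him, him'⟩ := intervalIntegrable_and_integral_clm_deriv Complex.imCLM hf
  have hint : IntervalIntegrable (deriv f) volume a b := by
    rw [intervalIntegrable_iff] at hre him ⊢
    exact Integrable.re_im_iff.1 ⟨hre, him⟩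
  rw [Complex.reCLM.intervalIntegral_comp_comm hint] at hre'
  rw [Complex.imCLM.intervalIntegral_comp_comm hint] at him'
  exact Complex.ext hre' him'

theorem integral_mul_deriv_add_of_absolutelyContinuous {f g g' : ℝ → ℂ} {a b : ℝ}
    (hf : AbsolutelyContinuousOnInterval f a b) (hg : ∀ t ∈ uIcc a b, HasDerivAt g (g' t) t)
    (hg' : ContinuousOn g' (uIcc a b)) :
    ∫ t in a..b, (g t * deriv f t + g' t * f t) = g b * f b - g a * f a := by
  obtain ⟨C, hC⟩ := isCompact_uIcc.exists_bound_of_continuousOn hg'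
  have hgLip : LipschitzOnWith C.toNNReal g (uIcc a b) :=
    (convex_uIcc a b).lipschitzOnWith_of_nnnorm_hasDerivWithin_le
      (fun t ht ↦ (hg t ht).hasDerivWithinAt)
      fun t ht ↦ NNReal.le_toNNReal_of_coe_le (hC t ht)
  have h := integral_deriv_of_absolutelyContinuous (hgLip.absolutelyContinuousOnInterval.smul hf)
  simp only [Pi.smul_apply', smul_eq_mul] at h
  rw [← h]
  refine intervalIntegral.integral_congr_ae ?_
  filter_upwards [ae_hasDerivAt_deriv_of_absolutelyContinuous hf] with t ht hmem
  rw [add_comm]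
  exact ((hg t (uIoc_subset_uIcc hmem)).mul (ht hmem)).deriv.symm

theorem integral_Ioc_eq_sub_of_tendsto {E : Type*} [NormedAddCommGroup E] [NormedSpace ℝ E]
    {φ G : ℝ → E} {a b : ℝ} {l : E} (hab : a < b) (hφ : IntegrableOn φ (Ioc a b))
    (hG : ∀ c ∈ Ioo a b, ∫ t in c..b, φ t = G b - G c) (hlim : Tendsto G (𝓝[>] a) (𝓝 l)) :
    ∫ t in Ioc a b, φ t = G b - l := by
  have hcont := intervalIntegral.continuousOn_primitive_interval_left (μ := volume) (f := φ)
    (a := a) (b := b) (by rwa [uIcc_of_le hab.le, integrableOn_Icc_iff_integrableOn_Ioc])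
  rw [uIcc_of_le hab.le] at hcont
  rw [← intervalIntegral.integral_of_le hab.le]
  refine tendsto_nhds_unique
    ((hcont a ⟨le_rfl, hab.le⟩).mono_left (nhdsWithin_le_of_mem (Icc_mem_nhdsGT hab)))
    ((hlim.const_sub (G b)).congr' ?_)
  filter_upwards [Ioo_mem_nhdsGT hab] with c hc using (hG c hc).symm

theorem integral_Ioi_eq_sub_of_tendsto {E : Type*} [NormedAddCommGroup E] [NormedSpace ℝ E]
    {φ G : ℝ → E} {a : ℝ} {l : E} (hφ : IntegrableOn φ (Ioi a))
    (hG : ∀ b, a < b → ∫ t in a..b, φ t = G b - G a) (hlim : Tendsto G atTop (𝓝 l)) :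
    ∫ t in Ioi a, φ t = l - G a := by
  refine tendsto_nhds_unique (intervalIntegral_tendsto_integral_Ioi a hφ tendsto_id)
    ((hlim.sub_const (G a)).congr' ?_)
  filter_upwards [eventually_gt_atTop a] with b hb using (hG b hb).symm

/-! ### The operators `₁P` -/

theorem hasDerivAt_legendreP_div (ν : ℂ) {x t : ℝ} (hx : 0 < x) (ht : 0 < t) :
    HasDerivAt (fun t ↦ legendreP ν (t / x)) (deriv (legendreP ν) (t / x) / x) t := by
  convert! (differentiableAt_legendreP ν (div_pos ht hx)).hasDerivAt.scomp t
    ((hasDerivAt_id t).div_const x) using 1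
  rw [Complex.real_smul, Complex.ofReal_div, Complex.ofReal_one, one_div_mul_eq_div]

theorem integral_legendreP_div_mul_deriv_add (ν : ℂ) {f : ℝ → ℂ} (hf : LocallyAC f) {a b x : ℝ}
    (hx : 0 < x) (ha : 0 < a) (hab : a < b) :
    ∫ t in a..b, (legendreP ν (t / x) * deriv f t + deriv (legendreP ν) (t / x) / x * f t) =
      legendreP ν (b / x) * f b - legendreP ν (a / x) * f a := by
  have hpos {t : ℝ} (ht : t ∈ uIcc a b) : 0 < t := ha.trans_le (uIcc_of_le hab.le ▸ ht).1
  refine integral_mul_deriv_add_of_absolutelyContinuous (hf a b ha hab)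
    (fun t ht ↦ hasDerivAt_legendreP_div ν hx (hpos ht)) ?_
  exact ((continuousOn_deriv_legendreP ν).comp (by fun_prop)
    fun t ht ↦ div_pos (hpos ht) hx).div_const _

theorem integrableOn_iff_of_eq_indicator {α E : Type*} [MeasurableSpace α]
    [NormedAddCommGroup E] {μ : Measure α} {φ ψ : α → E} {S T : Set α} (hS : MeasurableSet S)
    (hT : MeasurableSet T) (hST : S ⊆ T) (h : ∀ y ∈ T, φ y = S.indicator ψ y) :
    IntegrableOn φ T μ ↔ IntegrableOn ψ S μ := by
  rw [integrableOn_congr_fun h hT, integrableOn_indicator_iff hS, inter_eq_left.2 hST]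

theorem setIntegral_eq_of_eq_indicator {α E : Type*} [MeasurableSpace α]
    [NormedAddCommGroup E] [NormedSpace ℝ E] {μ : Measure α} {φ ψ : α → E} {S T : Set α}
    (hS : MeasurableSet S) (hT : MeasurableSet T) (hST : S ⊆ T)
    (h : ∀ y ∈ T, φ y = S.indicator ψ y) : ∫ y in T, φ y ∂μ = ∫ y in S, ψ y ∂μ := by
  rw [setIntegral_congr_fun hT h, setIntegral_indicator hS, inter_eq_right.2 hST]

theorem integrableOn_and_mellinConv_kerPzero {ν s : ℂ} (hs : s ∈ halfPzero) {f : ℝ → ℂ}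
    (hf : MellinConvergent f s) {x : ℝ} (hx : 0 < x) :
    IntegrableOn (fun t : ℝ ↦ deriv (legendreP ν) (t / x) / x * f t) (Ioc 0 x) ∧
      mellinConv (kerPzero ν) f x = -∫ t in Ioc 0 x, deriv (legendreP ν) (t / x) / x * f t := by
  have hind (y : ℝ) (hy : y ∈ Ioi 0) : kerPzero ν (x / y) * f y / (y : ℂ) =
      (Ioo 0 x).indicator (fun t ↦ -(deriv (legendreP ν) (t / x) / x * f t)) y := by
    have hyc : (y : ℂ) ≠ 0 := Complex.ofReal_ne_zero.2 (ne_of_gt hy)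
    have hxc : (x : ℂ) ≠ 0 := Complex.ofReal_ne_zero.2 hx.ne'
    by_cases h : y < x
    · rw [indicator_of_mem (show y ∈ Ioo 0 x from ⟨hy, h⟩), kerPzero,
        if_pos (by rwa [one_lt_div hy]), one_div_div, Complex.ofReal_div]
      field_simp
    · rw [indicator_of_notMem (fun h' ↦ h h'.2), kerPzero, if_neg (by rwa [one_lt_div hy]),
        zero_mul, zero_div]
  have hint := (integrableOn_iff_of_eq_indicator measurableSet_Ioo measurableSet_Ioi
    (fun y hy ↦ hy.1) hind).1 ((mellinAdmissible_kerPzero ν hs).integrableOn_mellinConv hf hx)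
  have heq := setIntegral_eq_of_eq_indicator (μ := volume) measurableSet_Ioo measurableSet_Ioi
    (fun y hy ↦ hy.1) hind
  rw [← integrableOn_Ioc_iff_integrableOn_Ioo] at hint
  rw [← integral_Ioc_eq_integral_Ioo, integral_neg] at heq
  exact ⟨integrable_neg_iff.1 hint, heq⟩

theorem integrableOn_and_mellinConv_kerPminus {ν s : ℂ} (hs : s ∈ halfPminus ν) {f : ℝ → ℂ}
    (hf : MellinConvergent f s) {x : ℝ} (hx : 0 < x) :
    IntegrableOn (fun t : ℝ ↦ deriv (legendreP ν) (t / x) / x * f t) (Ioi x) ∧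
      mellinConv (kerPminus ν) f x = ∫ t in Ioi x, deriv (legendreP ν) (t / x) / x * f t := by
  have hker := (mellinAdmissible_kerPminus hs).integrableOn_mellinConv hf hx
  have hind (y : ℝ) (hy : y ∈ Ioi 0) : kerPminus ν (x / y) * f y / (y : ℂ) =
      (Ioi x).indicator (fun t ↦ deriv (legendreP ν) (t / x) / x * f t) y := by
    have hyc : (y : ℂ) ≠ 0 := Complex.ofReal_ne_zero.2 (ne_of_gt hy)
    have hxc : (x : ℂ) ≠ 0 := Complex.ofReal_ne_zero.2 hx.ne'
    by_cases h : x < y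
    · rw [indicator_of_mem (mem_Ioi.2 h), kerPminus,
        if_pos ⟨div_pos hx hy, by rwa [div_lt_one hy]⟩, one_div_div, Complex.ofReal_div]
      field_simp
    · rw [indicator_of_notMem (notMem_Ioi.2 (not_lt.1 h)), kerPminus,
        if_neg (fun h' ↦ h ((div_lt_one hy).1 h'.2)), zero_mul, zero_div]
  exact ⟨(integrableOn_iff_of_eq_indicator measurableSet_Ioi measurableSet_Ioi
      (Ioi_subset_Ioi hx.le) hind).1 hker,
    setIntegral_eq_of_eq_indicator measurableSet_Ioi measurableSet_Ioi (Ioi_subset_Ioi hx.le) hind⟩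

theorem opPzero_eq_add_mellinConv {ν s : ℂ} (hs : s ∈ halfPzero) {f : ℝ → ℂ}
    (hfD : f ∈ domPzero ν) (hf : MellinConvergent f s) {x : ℝ} (hx : 0 < x) :
    opPzero ν f x = f x + mellinConv (kerPzero ν) f x := by
  obtain ⟨hac, hdom⟩ := hfD
  obtain ⟨hint, hlim⟩ := hdom x hx
  obtain ⟨hint', hconv⟩ := integrableOn_and_mellinConv_kerPzero hs hf hx
  have hparts := integral_Ioc_eq_sub_of_tendsto hx (hint.add hint')
    (fun c hc ↦ integral_legendreP_div_mul_deriv_add ν hac hx hc.1 hc.2) hlim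
  simp only [Pi.add_apply] at hparts
  rw [integral_add hint hint', div_self hx.ne', legendreP_one, one_mul, sub_zero] at hparts
  rw [hconv, opPzero]
  linear_combination hparts

theorem opPminus_eq_add_mellinConv {ν s : ℂ} (hs : s ∈ halfPminus ν) {f : ℝ → ℂ}
    (hfD : f ∈ domPminus ν) (hf : MellinConvergent f s) {x : ℝ} (hx : 0 < x) :
    opPminus ν f x = f x + mellinConv (kerPminus ν) f x := by
  obtain ⟨hac, hdom⟩ := hfD
  obtain ⟨hint, hlim⟩ := hdom x hx
  simp only [mul_neg] at hint
  rw [IntegrableOn, integrable_fun_neg_iff] at hint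
  obtain ⟨hint', hconv⟩ := integrableOn_and_mellinConv_kerPminus hs hf hx
  have hparts := integral_Ioi_eq_sub_of_tendsto (hint.add hint')
    (fun b hb ↦ integral_legendreP_div_mul_deriv_add ν hac hx hx hb) hlim
  simp only [Pi.add_apply] at hparts
  rw [integral_add hint hint', div_self hx.ne', legendreP_one, one_mul, zero_sub] at hparts
  rw [hconv, opPminus]
  simp only [mul_neg, integral_neg]
  linear_combination -hparts

theorem actsAsMellinConvolution_opPzero (ν : ℂ) :
    ActsAsMellinConvolution (opPzero ν) (domPzero ν) (kerPzero ν) halfPzero :=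
  actsAsMellinConvolution_of_ae_eq (fun _ hs ↦ mellinAdmissible_kerPzero ν hs)
    fun _ hs _ hfD hf ↦ (ae_restrict_mem measurableSet_Ioi).mono
      fun _ hx ↦ opPzero_eq_add_mellinConv hs hfD hf hx

theorem actsAsMellinConvolution_opPminus (ν : ℂ) :
    ActsAsMellinConvolution (opPminus ν) (domPminus ν) (kerPminus ν) (halfPminus ν) :=
  actsAsMellinConvolution_of_ae_eq (fun _ hs ↦ mellinAdmissible_kerPminus hs)
    fun _ hs _ hfD hf ↦ (ae_restrict_mem measurableSet_Ioi).mono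
      fun _ hx ↦ opPminus_eq_add_mellinConv hs hfD hf hx

/-! ### The operators `₁S` -/

/-- `J` is a primitive on `(0, ∞)` of the measure `δ₁ + k(u) du`, the kernel of a Mellin
convolution operator. The mass at `1` is counted in `(a, z]`. -/
def IsPrimitiveDiracAdd (k J : ℝ → ℂ) : Prop :=
  ∀ a z : ℝ, 0 < a → a < z →
    (Ioc a z).indicator 1 (1 : ℝ) + ∫ u in a..z, k u = J z - J a

theorem isPrimitiveDiracAdd_ite {k p q : ℝ → ℂ} (hp : ContinuousOn p (Ioi 0))
    (hq : ContinuousOn q (Ioi 0)) (hpq : p 1 - q 1 = 1)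
    (hpk : ∀ u, 1 < u → HasDerivAt p (k u) u) (hqk : ∀ u, 0 < u → u < 1 → HasDerivAt q (k u) u)
    (hk : ∀ a z : ℝ, 0 < a → IntegrableOn k (Icc a z)) :
    IsPrimitiveDiracAdd k fun u ↦ if 1 ≤ u then p u else q u := by
  intro a z ha haz
  have hint : ∫ u in a..z, k u =
      p (max z 1) + q (min z 1) - (p (max a 1) + q (min a 1)) := by
    refine integral_eq_of_hasDerivAt_off_countable (fun u ↦ p (max u 1) + q (min u 1)) _
      (countable_singleton 1) ?_ (fun u hu ↦ ?_)
      ((intervalIntegrable_iff_integrableOn_Icc_of_le haz.le).2 (hk a z ha))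
    · rw [uIcc_of_le haz.le]
      exact (hp.comp (by fun_prop) fun u _ ↦ zero_lt_one.trans_le (le_max_right u 1)).add
        (hq.comp (by fun_prop) fun u hu ↦ lt_min (ha.trans_le hu.1) zero_lt_one)
    · have hu0 : 0 < u := (lt_min ha (ha.trans haz)).trans hu.1.1
      rcases lt_or_gt_of_ne hu.2 with h | h
      · refine ((hqk u hu0 h).const_add (p 1)).congr_of_eventuallyEq ?_
        filter_upwards [Iio_mem_nhds h] with v hv
        rw [max_eq_right (le_of_lt hv), min_eq_left (le_of_lt hv)]
      · refine ((hpk u h).add_const (q 1)).congr_of_eventuallyEq ?_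
        filter_upwards [Ioi_mem_nhds h] with v hv
        rw [max_eq_left (le_of_lt hv), min_eq_right (le_of_lt hv)]
  rw [hint, indicator_apply, Pi.one_apply]
  grind

theorem IsPrimitiveDiracAdd.integral_comp_div {k J : ℝ → ℂ} (hJ : IsPrimitiveDiracAdd k J)
    {a z y : ℝ} (ha : 0 < a) (haz : a < z) (hy : 0 < y) :
    ∫ w in a..z, k (w / y) / (y : ℂ) = J (z / y) - J (a / y) - (Ioc a z).indicator 1 y := by
  have hmem : (Ioc (a / y) (z / y)).indicator (1 : ℝ → ℂ) 1 = (Ioc a z).indicator 1 y := by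
    simp only [indicator_apply, mem_Ioc, div_lt_one hy, one_le_div hy, Pi.one_apply]
  have hyc : (y : ℂ) ≠ 0 := Complex.ofReal_ne_zero.2 hy.ne'
  rw [← hJ _ _ (div_pos ha hy) (div_lt_div_of_pos_right haz hy), hmem, add_sub_cancel_left,
    intervalIntegral.integral_div, intervalIntegral.integral_comp_div k hy.ne', Complex.real_smul,
    mul_div_cancel_left₀ _ hyc]

theorem integral_mellinConv {k f J : ℝ → ℂ} {s : ℂ} (hk : MellinAdmissible k s)
    (hJ : IsPrimitiveDiracAdd k J) (hf : MellinConvergent f s) {a z : ℝ} (ha : 0 < a)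
    (haz : a < z) :
    ∫ w in a..z, mellinConv k f w =
      ∫ y in Ioi 0, (J (z / y) * f y - J (a / y) * f y - (Ioc a z).indicator f y) := by
  have hswap := integral_integral_swap (f := fun w y : ℝ ↦ k (w / y) * f y / (y : ℂ))
    (hk.integrable_mellinConv_prod_Ioc hf (z := z) ha)
  rw [intervalIntegral.integral_of_le haz.le]
  refine hswap.trans (setIntegral_congr_fun measurableSet_Ioi fun y hy ↦ ?_)
  have hinner := hJ.integral_comp_div ha haz hy
  rw [intervalIntegral.integral_of_le haz.le] at hinner
  calc ∫ w in Ioc a z, k (w / y) * f y / (y : ℂ)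
      = (∫ w in Ioc a z, k (w / y) / (y : ℂ)) * f y := by
        simp only [← integral_mul_const, div_mul_eq_mul_div]
    _ = J (z / y) * f y - J (a / y) * f y - (Ioc a z).indicator f y := by
      rw [hinner, sub_mul, sub_mul, indicator_apply, indicator_apply, ite_mul, zero_mul,
        Pi.one_apply, one_mul]

theorem integral_add_mellinConv_eq_sub {k f J : ℝ → ℂ} {s : ℂ} (hk : MellinAdmissible k s)
    (hJ : IsPrimitiveDiracAdd k J) (hf : MellinConvergent f s)
    (hJf : ∀ x : ℝ, 0 < x → IntegrableOn (fun y ↦ J (x / y) * f y) (Ioi 0)) {a z : ℝ}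
    (ha : 0 < a) (haz : a < z) :
    ∫ w in a..z, (f w + mellinConv k f w) =
      (∫ y in Ioi 0, J (z / y) * f y) - ∫ y in Ioi 0, J (a / y) * f y := by
  have hfi : IntegrableOn f (Icc a z) := integrableOn_Icc_of_mellinConvergent hf ha
  have hci : IntegrableOn (mellinConv k f) (Icc a z) := integrableOn_Icc_of_mellinConvergent
    (mellinConvergent_mellinConv hk.measurable hk.mellinConvergent hf) ha
  have hind : IntegrableOn ((Ioc a z).indicator f) (Ioi 0) :=
    ((integrable_indicator_iff measurableSet_Ioc).2
      (hfi.mono_set Ioc_subset_Icc_self)).integrableOn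
  have hz := hJf z (ha.trans haz)
  have hdiff : IntegrableOn (fun y ↦ J (z / y) * f y - J (a / y) * f y) (Ioi 0) :=
    hz.sub (hJf a ha)
  have hsub : Ioc a z ⊆ Ioi 0 := fun t ht ↦ ha.trans ht.1
  rw [← intervalIntegrable_iff_integrableOn_Icc_of_le haz.le] at hfi hci
  rw [intervalIntegral.integral_add hfi hci, integral_mellinConv hk hJ hf ha haz,
    integral_sub hdiff hind, integral_sub hz (hJf a ha),
    setIntegral_indicator measurableSet_Ioc, inter_eq_right.2 hsub,
    intervalIntegral.integral_of_le haz.le]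
  ring

theorem ae_hasDerivAt_of_integral_eq_sub {F g : ℝ → ℂ}
    (hg : ∀ a b : ℝ, 0 < a → IntegrableOn g (Icc a b))
    (hF : ∀ a z : ℝ, 0 < a → a < z → ∫ w in a..z, g w = F z - F a) :
    ∀ᵐ x ∂(volume.restrict (Ioi (0 : ℝ))), HasDerivAt F (g x) x := by
  rw [ae_restrict_iff' measurableSet_Ioi]
  have hprim (n : ℕ) : ∀ᵐ x : ℝ, x ∈ uIcc (1 / (n + 1) : ℝ) (n + 1) →
      ∀ c ∈ uIcc (1 / (n + 1) : ℝ) (n + 1), HasDerivAt (fun x ↦ ∫ t in c..x, g t) (g x) x := by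
    have hle : (1 / (n + 1) : ℝ) ≤ n + 1 := by
      rw [div_le_iff₀ (by positivity)]
      nlinarith [(Nat.cast_nonneg n : (0 : ℝ) ≤ n)]
    refine IntervalIntegrable.ae_hasDerivAt_integral ?_
    rw [intervalIntegrable_iff_integrableOn_Icc_of_le hle]
    exact hg _ _ (by positivity)
  filter_upwards [ae_all_iff.2 hprim] with x hx hx0
  obtain ⟨n, hn⟩ := exists_nat_gt (max x (1 / x))
  obtain ⟨hxn, hn'⟩ := max_lt_iff.1 hn
  have hnx : (1 / (n + 1) : ℝ) < x := by
    rw [one_div_lt (by positivity) hx0]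
    linarith
  have hmem : x ∈ uIcc (1 / (n + 1) : ℝ) (n + 1) := Icc_subset_uIcc ⟨hnx.le, by linarith⟩
  refine ((hx n hmem _ left_mem_uIcc).add_const (F (1 / (n + 1)))).congr_of_eventuallyEq ?_
  filter_upwards [Ioi_mem_nhds hnx] with y hy
  rw [hF _ _ (by positivity) hy, sub_add_cancel]

theorem ae_hasDerivAt_setIntegral_primitive {k f J : ℝ → ℂ} {s : ℂ} (hk : MellinAdmissible k s)
    (hJ : IsPrimitiveDiracAdd k J) (hf : MellinConvergent f s)
    (hJf : ∀ x : ℝ, 0 < x → IntegrableOn (fun y ↦ J (x / y) * f y) (Ioi 0)) :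
    ∀ᵐ x ∂(volume.restrict (Ioi (0 : ℝ))), HasDerivAt
      (fun z ↦ ∫ y in Ioi 0, J (z / y) * f y) (f x + mellinConv k f x) x := by
  have hconv := mellinConvergent_mellinConv hk.measurable hk.mellinConvergent hf
  exact ae_hasDerivAt_of_integral_eq_sub (fun _ _ ha ↦ (integrableOn_Icc_of_mellinConvergent hf
    ha).add (integrableOn_Icc_of_mellinConvergent hconv ha))
    fun _ _ ha haz ↦ integral_add_mellinConv_eq_sub hk hJ hf hJf ha haz

theorem isPrimitiveDiracAdd_kerSzero {ν s : ℂ} (hk : MellinConvergent (kerSzero ν) s) :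
    IsPrimitiveDiracAdd (kerSzero ν) fun u ↦ if 1 ≤ u then legendreP ν u else 0 := by
  refine isPrimitiveDiracAdd_ite (continuousOn_legendreP ν) continuousOn_const
    (by rw [legendreP_one, sub_zero]) (fun u hu ↦ ?_) (fun u _ hu ↦ ?_)
    fun _ _ ha ↦ integrableOn_Icc_of_mellinConvergent hk ha
  · rw [kerSzero, if_pos hu]
    exact (differentiableAt_legendreP ν (one_pos.trans hu)).hasDerivAt
  · rw [kerSzero, if_neg hu.not_gt]
    exact hasDerivAt_const u 0

theorem isPrimitiveDiracAdd_kerSminus {ν s : ℂ} (hk : MellinConvergent (kerSminus ν) s) :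
    IsPrimitiveDiracAdd (kerSminus ν) fun u ↦ if 1 ≤ u then 0 else -legendreP ν u := by
  refine isPrimitiveDiracAdd_ite continuousOn_const (continuousOn_legendreP ν).neg
    (by rw [legendreP_one, sub_neg_eq_add, zero_add]) (fun u hu ↦ ?_) (fun u hu0 hu ↦ ?_)
    fun _ _ ha ↦ integrableOn_Icc_of_mellinConvergent hk ha
  · rw [kerSminus, if_neg fun h ↦ h.2.not_gt hu]
    exact hasDerivAt_const u 0
  · rw [kerSminus, if_pos ⟨hu0, hu⟩]
    exact (differentiableAt_legendreP ν hu0).hasDerivAt.neg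

theorem ae_hasDerivAt_integral_opSzero {ν s : ℂ} (hs : s ∈ halfSzero ν) {f : ℝ → ℂ}
    (hfD : f ∈ domSzero ν) (hf : MellinConvergent f s) :
    ∀ᵐ x ∂(volume.restrict (Ioi (0 : ℝ))), HasDerivAt
      (fun z : ℝ ↦ ∫ t in Ioc 0 z, legendreP ν (z / t) * f t)
      (f x + mellinConv (kerSzero ν) f x) x := by
  have hk := mellinAdmissible_kerSzero hs
  have hind (z t : ℝ) (ht : t ∈ Ioi 0) : (if 1 ≤ z / t then legendreP ν (z / t) else 0) * f t =
      (Ioc 0 z).indicator (fun t ↦ legendreP ν (z / t) * f t) t := by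
    simp only [indicator_apply, mem_Ioc, mem_Ioi.1 ht, true_and, one_le_div (mem_Ioi.1 ht),
      ite_mul, zero_mul]
  have hsub (z : ℝ) : Ioc 0 z ⊆ Ioi 0 := fun t ht ↦ ht.1
  have hae := ae_hasDerivAt_setIntegral_primitive hk
    (isPrimitiveDiracAdd_kerSzero hk.mellinConvergent) hf fun x hx ↦
      (integrableOn_iff_of_eq_indicator measurableSet_Ioc measurableSet_Ioi (hsub x)
        (hind x)).2 (hfD x hx)
  filter_upwards [hae] with x hx
  refine hx.congr_of_eventuallyEq (.of_forall fun z ↦ ?_)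
  exact (setIntegral_eq_of_eq_indicator measurableSet_Ioc measurableSet_Ioi (hsub z)
    (hind z)).symm

theorem ae_hasDerivAt_integral_opSminus {ν s : ℂ} (hs : s ∈ halfSminus) {f : ℝ → ℂ}
    (hfD : f ∈ domSminus ν) (hf : MellinConvergent f s) :
    ∀ᵐ x ∂(volume.restrict (Ioi (0 : ℝ))), HasDerivAt
      (fun z : ℝ ↦ ∫ t in Ioi z, legendreP ν (z / t) * f t)
      (-(f x + mellinConv (kerSminus ν) f x)) x := by
  have hk := mellinAdmissible_kerSminus ν hs
  have hind (z t : ℝ) (ht : t ∈ Ioi 0) : (if 1 ≤ z / t then 0 else -legendreP ν (z / t)) * f t =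
      (Ioi z).indicator (fun t ↦ -(legendreP ν (z / t) * f t)) t := by
    simp only [indicator_apply, mem_Ioi, one_le_div (mem_Ioi.1 ht)]
    grind
  have hae := ae_hasDerivAt_setIntegral_primitive hk
    (isPrimitiveDiracAdd_kerSminus hk.mellinConvergent) hf fun x hx ↦
      (integrableOn_iff_of_eq_indicator measurableSet_Ioi measurableSet_Ioi
        (Ioi_subset_Ioi hx.le) (hind x)).2 (hfD x hx).neg
  filter_upwards [hae, ae_restrict_mem measurableSet_Ioi] with x hx hx0
  refine hx.neg.congr_of_eventuallyEq ?_
  filter_upwards [Ioi_mem_nhds hx0] with z hz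
  rw [Pi.neg_apply, setIntegral_eq_of_eq_indicator measurableSet_Ioi measurableSet_Ioi
    (Ioi_subset_Ioi (le_of_lt hz)) (hind z), integral_neg, neg_neg]

theorem actsAsMellinConvolution_opSzero (ν : ℂ) :
    ActsAsMellinConvolution (opSzero ν) (domSzero ν) (kerSzero ν) (halfSzero ν) :=
  actsAsMellinConvolution_of_ae_eq (fun _ hs ↦ mellinAdmissible_kerSzero hs)
    fun _ hs _ hfD hf ↦ (ae_hasDerivAt_integral_opSzero hs hfD hf).mono fun _ hx ↦ hx.deriv

theorem actsAsMellinConvolution_opSminus (ν : ℂ) :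
    ActsAsMellinConvolution (opSminus ν) (domSminus ν) (kerSminus ν) halfSminus :=
  actsAsMellinConvolution_of_ae_eq (fun _ hs ↦ mellinAdmissible_kerSminus ν hs)
    fun _ hs _ hfD hf ↦ (ae_hasDerivAt_integral_opSminus hs hfD hf).mono
      fun x hx ↦ by rw [opSminus, hx.deriv, neg_neg]

/-! ### Gamma ratios -/

theorem tendsto_inv_GammaSeq (w : ℂ) :
    Tendsto (fun n ↦ (Complex.GammaSeq w n)⁻¹) atTop (𝓝 (Complex.Gamma w)⁻¹) := by
  by_cases hw : Complex.Gamma w = 0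
  · obtain ⟨m, hm⟩ := (Complex.Gamma_eq_zero_iff w).1 hw
    rw [hw, inv_zero]
    refine tendsto_const_nhds.congr' ?_
    filter_upwards [eventually_ge_atTop m] with n hn
    rw [Complex.GammaSeq, Finset.prod_eq_zero (Finset.mem_range.2 (Nat.lt_succ_of_le hn))
      (by rw [hm, neg_add_cancel]), div_zero, inv_zero]
  · exact (Complex.GammaSeq_tendsto_Gamma w).inv₀ hw

theorem GammaSeq_ratio_eq_prod {a b x y : ℂ} (h : a + b = x + y) {n : ℕ} (hn : n ≠ 0) :
    Complex.GammaSeq x n * Complex.GammaSeq y n *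
        ((Complex.GammaSeq a n)⁻¹ * (Complex.GammaSeq b n)⁻¹) =
      ∏ j ∈ Finset.range (n + 1), ((a + j) * (b + j) / ((x + j) * (y + j))) := by
  have hn' : (n : ℂ) ≠ 0 := Nat.cast_ne_zero.2 hn
  have hfact : (n.factorial : ℂ) ≠ 0 := Nat.cast_ne_zero.2 n.factorial_ne_zero
  have hpow : (n : ℂ) ^ x * (n : ℂ) ^ y = (n : ℂ) ^ a * (n : ℂ) ^ b := by
    rw [← Complex.cpow_add _ _ hn', ← Complex.cpow_add _ _ hn', h]
  have hpow_ne : (n : ℂ) ^ a * (n : ℂ) ^ b ≠ 0 := by simp [Complex.cpow_eq_zero_iff, hn']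
  rw [Finset.prod_div_distrib, Finset.prod_mul_distrib, Finset.prod_mul_distrib]
  simp only [Complex.GammaSeq, inv_div]
  generalize ∏ j ∈ Finset.range (n + 1), (a + (j : ℂ)) = A
  generalize ∏ j ∈ Finset.range (n + 1), (b + (j : ℂ)) = B
  generalize ∏ j ∈ Finset.range (n + 1), (x + (j : ℂ)) = X
  generalize ∏ j ∈ Finset.range (n + 1), (y + (j : ℂ)) = Y
  calc _ = ((n : ℂ) ^ x * (n : ℂ) ^ y) / ((n : ℂ) ^ a * (n : ℂ) ^ b) *
        (n.factorial * n.factorial / (n.factorial * n.factorial)) * (A * B / (X * Y)) := by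
        simp only [div_eq_mul_inv, mul_inv]
        ring
    _ = _ := by rw [hpow, div_self hpow_ne, div_self (mul_ne_zero hfact hfact), one_mul, one_mul]

theorem tendsto_prod_Gamma_ratio {a b x y : ℂ} (h : a + b = x + y) :
    Tendsto (fun n : ℕ ↦ ∏ j ∈ Finset.range (n + 1), ((a + j) * (b + j) / ((x + j) * (y + j))))
      atTop (𝓝 (Complex.Gamma x * Complex.Gamma y / (Complex.Gamma a * Complex.Gamma b))) := by
  have hlim := ((Complex.GammaSeq_tendsto_Gamma x).mul (Complex.GammaSeq_tendsto_Gamma y)).mul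
    ((tendsto_inv_GammaSeq a).mul (tendsto_inv_GammaSeq b))
  rw [← mul_inv, ← div_eq_mul_inv] at hlim
  refine hlim.congr' ?_
  filter_upwards [eventually_ne_atTop 0] with n hn using GammaSeq_ratio_eq_prod h hn

theorem eq_Gamma_ratio_of_recurrence {a b x y : ℂ} (h : a + b = x + y) {G : ℕ → ℂ}
    (hxy : ∀ n : ℕ, (x + n) * (y + n) ≠ 0)
    (hG : ∀ n : ℕ, (x + n) * (y + n) * G n = (a + n) * (b + n) * G (n + 1))
    (hlim : Tendsto G atTop (𝓝 1)) :
    G 0 = Complex.Gamma x * Complex.Gamma y / (Complex.Gamma a * Complex.Gamma b) := by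
  have hprod (n : ℕ) :
      G 0 = (∏ j ∈ Finset.range n, ((a + j) * (b + j) / ((x + j) * (y + j)))) * G n := by
    induction n with
    | zero => rw [Finset.range_zero, Finset.prod_empty, one_mul]
    | succ n ih =>
      rw [ih, Finset.prod_range_succ, mul_assoc, div_mul_eq_mul_div, ← hG n,
        mul_div_cancel_left₀ _ (hxy n)]
  have hmul := (tendsto_prod_Gamma_ratio h).mul (hlim.comp (tendsto_add_atTop_nat 1))
  rw [mul_one] at hmul
  exact tendsto_nhds_unique (tendsto_const_nhds.congr fun n ↦ hprod (n + 1)) hmul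

/-! ### Recurrences of the multipliers -/

/-- The primitive of `(s(s+1) u^(s-1) - (s-ν)(s+ν+1) u^(s+1)) P_ν'(u)` that one finds by applying
the Legendre equation to `u^s (1-u²) P_ν'(u)`; it relates the Mellin transforms of `P_ν'` at `s`
and `s + 2`. -/
noncomputable def legendreMellinPrimitive (ν s : ℂ) (u : ℝ) : ℂ :=
  (s + 1) * ((u : ℂ) ^ s * ((1 - (u : ℂ) ^ 2) * deriv (legendreP ν) u)) +
    ν * (ν + 1) * ((u : ℂ) ^ (s + 1) * legendreP ν u)

theorem legendreMellinPrimitive_one (ν s : ℂ) :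
    legendreMellinPrimitive ν s 1 = ν * (ν + 1) := by
  simp [legendreMellinPrimitive, legendreP_one]

theorem hasDerivAt_ofReal_cpow_const_of_pos {u : ℝ} (hu : 0 < u) (r : ℂ) :
    HasDerivAt (fun u : ℝ ↦ (u : ℂ) ^ r) (r * (u : ℂ) ^ (r - 1)) u := by
  simpa using (hasDerivAt_id (u : ℂ)).cpow_const (c := r) (Complex.ofReal_mem_slitPlane.2 hu)
    |>.comp_ofReal

theorem hasDerivAt_legendreMellinPrimitive (ν s : ℂ) {u : ℝ} (hu : 0 < u) :
    HasDerivAt (legendreMellinPrimitive ν s)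
      ((s * (s + 1) * (u : ℂ) ^ (s - 1) - (s - ν) * (s + ν + 1) * (u : ℂ) ^ (s + 2 - 1)) *
        deriv (legendreP ν) u) u := by
  have huc : (u : ℂ) ≠ 0 := Complex.ofReal_ne_zero.2 hu.ne'
  convert! (((hasDerivAt_ofReal_cpow_const_of_pos hu s).mul (legendre_ode ν hu)).const_mul
    (s + 1)).add (((hasDerivAt_ofReal_cpow_const_of_pos hu (s + 1)).mul
      (differentiableAt_legendreP ν hu).hasDerivAt).const_mul (ν * (ν + 1))) using 1
  rw [show s + 2 - 1 = s + 1 by ring, add_sub_cancel_right, Complex.cpow_add _ _ huc,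
    Complex.cpow_sub _ _ huc, Complex.cpow_one]
  field_simp
  ring

theorem tendsto_ofReal_cpow_nhdsGT_zero {s : ℂ} (hs : 0 < s.re) :
    Tendsto (fun u : ℝ ↦ (u : ℂ) ^ s) (𝓝[>] 0) (𝓝 0) := by
  have hlim := (Complex.continuousAt_ofReal_cpow_const 0 s (.inl hs)).tendsto
  rw [Complex.ofReal_zero, Complex.zero_cpow (by rintro rfl; exact hs.false)] at hlim
  exact hlim.mono_left nhdsWithin_le_nhds

theorem tendsto_legendreMellinPrimitive_nhdsGT_zero (ν : ℂ) {s : ℂ} (hs : 0 < s.re) :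
    Tendsto (legendreMellinPrimitive ν s) (𝓝[>] 0) (𝓝 0) := by
  obtain ⟨C, hC⟩ := exists_norm_legendreP_le_of_le_one ν
  have hbdd {φ : ℝ → ℂ} (hφ : ∀ z : ℝ, 0 < z → z ≤ 1 → ‖φ z‖ ≤ C) :
      IsBoundedUnder (· ≤ ·) (𝓝[>] 0) ((‖·‖) ∘ φ) := by
    refine ⟨C, eventually_map.2 ?_⟩
    filter_upwards [Ioo_mem_nhdsGT one_pos] with z hz using hφ z hz.1 hz.2.le
  have hderiv (z : ℝ) (hz0 : 0 < z) (hz1 : z ≤ 1) :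
      ‖(1 - (z : ℂ) ^ 2) * deriv (legendreP ν) z‖ ≤ C := by
    have hle : ‖1 - (z : ℂ) ^ 2‖ ≤ 1 := by
      rw [← Complex.ofReal_one, ← Complex.ofReal_pow, ← Complex.ofReal_sub, Complex.norm_real,
        Real.norm_of_nonneg (by nlinarith)]
      nlinarith
    rw [norm_mul]
    exact (mul_le_of_le_one_left (norm_nonneg _) hle).trans (hC z hz0 hz1).2
  have hs1 : 0 < (s + 1).re := by
    rw [Complex.add_re, Complex.one_re]
    linarith
  have hlim := (((tendsto_ofReal_cpow_nhdsGT_zero hs).zero_mul_isBoundedUnder_le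
    (hbdd hderiv)).const_mul (s + 1)).add
    (((tendsto_ofReal_cpow_nhdsGT_zero hs1).zero_mul_isBoundedUnder_le
      (hbdd fun z hz0 hz1 ↦ (hC z hz0 hz1).1)).const_mul (ν * (ν + 1)))
  rwa [mul_zero, mul_zero, add_zero] at hlim

theorem tendsto_cpow_mul_atTop {φ : ℝ → ℂ} {s : ℂ} {C r : ℝ}
    (hφ : ∀ u : ℝ, 1 ≤ u → ‖φ u‖ ≤ C * u ^ r) (hr : s.re + r < 0) :
    Tendsto (fun u : ℝ ↦ (u : ℂ) ^ s * φ u) atTop (𝓝 0) := by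
  have hlim := (tendsto_rpow_neg_atTop (y := -(s.re + r)) (by linarith)).const_mul C
  rw [mul_zero, neg_neg] at hlim
  refine squeeze_zero_norm' ?_ hlim
  filter_upwards [eventually_ge_atTop 1] with u hu
  have hu0 : 0 < u := one_pos.trans_le hu
  rw [norm_mul, Complex.norm_cpow_eq_rpow_re_of_pos hu0, Real.rpow_add hu0, mul_left_comm]
  exact mul_le_mul_of_nonneg_left (hφ u hu) (by positivity)

theorem norm_one_sub_sq_mul_le_rpow {w : ℂ} {C r u : ℝ} (hu : 1 ≤ u)
    (hw : ‖w‖ ≤ C * u ^ (r - 1)) : ‖(1 - (u : ℂ) ^ 2) * w‖ ≤ C * u ^ (r + 1) := by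
  have hu0 : 0 < u := one_pos.trans_le hu
  have hle : ‖1 - (u : ℂ) ^ 2‖ ≤ u ^ (2 : ℝ) := by
    rw [← Complex.ofReal_one, ← Complex.ofReal_pow, ← Complex.ofReal_sub, Complex.norm_real,
      Real.norm_of_nonpos (by nlinarith), Real.rpow_two]
    linarith
  calc ‖(1 - (u : ℂ) ^ 2) * w‖ ≤ u ^ (2 : ℝ) * (C * u ^ (r - 1)) := by
        rw [norm_mul]
        gcongr
    _ = C * u ^ (r + 1) := by
        rw [mul_left_comm, ← Real.rpow_add hu0]
        ring_nf

theorem tendsto_legendreMellinPrimitive_atTop {ν s : ℂ} (hs : s + 2 ∈ halfSzero ν) :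
    Tendsto (legendreMellinPrimitive ν s) atTop (𝓝 0) := by
  obtain ⟨hs1, hs2⟩ := lt_min_iff.1 (mem_ofPred.1 hs)
  rw [Complex.add_re, Complex.re_ofNat] at hs1 hs2
  obtain ⟨r, hr, hrs⟩ := exists_between
    (max_lt (by linarith : ν.re < -1 - s.re) (by linarith : -1 - ν.re < -1 - s.re))
  obtain ⟨hr1, hr2⟩ := max_lt_iff.1 hr
  obtain ⟨C, hC⟩ := exists_norm_legendreP_le_rpow ν hr1 hr2
  obtain ⟨C', hC'⟩ := exists_norm_deriv_legendreP_le_rpow ν hr1 hr2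
  have hP : Tendsto (fun u : ℝ ↦ (u : ℂ) ^ (s + 1) * legendreP ν u) atTop (𝓝 0) :=
    tendsto_cpow_mul_atTop hC (by rw [Complex.add_re, Complex.one_re]; linarith)
  have hP' : Tendsto (fun u : ℝ ↦ (u : ℂ) ^ s * ((1 - (u : ℂ) ^ 2) * deriv (legendreP ν) u))
      atTop (𝓝 0) :=
    tendsto_cpow_mul_atTop (fun u hu ↦ norm_one_sub_sq_mul_le_rpow hu (hC' u hu)) (by linarith)
  have hlim := (hP'.const_mul (s + 1)).add (hP.const_mul (ν * (ν + 1)))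
  rwa [mul_zero, mul_zero, add_zero] at hlim

theorem mem_halfSzero_of_re_le {ν s t : ℂ} (ht : t ∈ halfSzero ν) (h : s.re ≤ t.re) :
    s ∈ halfSzero ν :=
  h.trans_lt ht

theorem mem_halfSminus_of_re_le {s t : ℂ} (hs : s ∈ halfSminus) (h : s.re ≤ t.re) :
    t ∈ halfSminus :=
  hs.trans_le h

theorem integrableOn_and_integral_sub_cpow_mul {k : ℝ → ℂ} {s t : ℂ} (hs : MellinConvergent k s)
    (ht : MellinConvergent k t) (α β : ℂ) :
    IntegrableOn (fun u : ℝ ↦ (α * (u : ℂ) ^ (s - 1) - β * (u : ℂ) ^ (t - 1)) * k u) (Ioi 0) ∧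
      ∫ u in Ioi (0 : ℝ), (α * (u : ℂ) ^ (s - 1) - β * (u : ℂ) ^ (t - 1)) * k u =
        α * mellin k s - β * mellin k t := by
  have heq : (fun u : ℝ ↦ (α * (u : ℂ) ^ (s - 1) - β * (u : ℂ) ^ (t - 1)) * k u) =
      fun u : ℝ ↦ α * ((u : ℂ) ^ (s - 1) • k u) - β * ((u : ℂ) ^ (t - 1) • k u) := by
    funext u
    simp only [smul_eq_mul, sub_mul, mul_assoc]
  have hs' := Integrable.const_mul hs α
  have ht' := Integrable.const_mul ht β
  rw [heq]
  exact ⟨hs'.sub ht', by rw [integral_sub hs' ht', integral_const_mul, integral_const_mul]; rfl⟩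

theorem multiplier_recurrence_of_integral {k : ℝ → ℂ} {ν s : ℂ} (hs : MellinConvergent k s)
    (hs2 : MellinConvergent k (s + 2))
    (h : ∫ u in Ioi (0 : ℝ), (s * (s + 1) * (u : ℂ) ^ (s - 1) -
      (s - ν) * (s + ν + 1) * (u : ℂ) ^ (s + 2 - 1)) * k u = -(ν * (ν + 1))) :
    s * (s + 1) * multiplier k s = (s - ν) * (s + ν + 1) * multiplier k (s + 2) := by
  rw [(integrableOn_and_integral_sub_cpow_mul hs hs2 _ _).2] at h
  rw [multiplier, multiplier]
  linear_combination h

theorem multiplier_kerSminus_recurrence (ν : ℂ) {s : ℂ} (hs : s ∈ halfSminus) :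
    s * (s + 1) * multiplier (kerSminus ν) s =
      (s - ν) * (s + ν + 1) * multiplier (kerSminus ν) (s + 2) := by
  have hk := (mellinAdmissible_kerSminus ν hs).mellinConvergent
  have hk2 := (mellinAdmissible_kerSminus ν (mem_halfSminus_of_re_le hs
    (by simp : s.re ≤ (s + 2).re))).mellinConvergent
  refine multiplier_recurrence_of_integral hk hk2 ?_
  set w : ℝ → ℂ := fun u ↦ s * (s + 1) * (u : ℂ) ^ (s - 1) -
    (s - ν) * (s + ν + 1) * (u : ℂ) ^ (s + 2 - 1)
  have hind (u : ℝ) (_ : u ∈ Ioi 0) : w u * kerSminus ν u =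
      (Ioo 0 1).indicator (fun u ↦ -(w u * deriv (legendreP ν) u)) u := by
    simp only [kerSminus, indicator_apply, mem_Ioo, mul_ite, mul_neg, mul_zero]
  have hsub : Ioo (0 : ℝ) 1 ⊆ Ioi 0 := fun u hu ↦ hu.1
  have hint := (integrableOn_iff_of_eq_indicator measurableSet_Ioo measurableSet_Ioi hsub hind).1
    (integrableOn_and_integral_sub_cpow_mul hk hk2 _ _).1
  rw [← integrableOn_Ioc_iff_integrableOn_Ioo] at hint
  have hftc := intervalIntegral.integral_eq_sub_of_hasDerivAt_of_tendsto one_pos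
    (fun u hu ↦ hasDerivAt_legendreMellinPrimitive ν s hu.1)
    ((intervalIntegrable_iff_integrableOn_Ioc_of_le zero_le_one).2 (integrable_neg_iff.1 hint))
    (tendsto_legendreMellinPrimitive_nhdsGT_zero ν hs)
    ((hasDerivAt_legendreMellinPrimitive ν s one_pos).continuousAt.tendsto.mono_left
      nhdsWithin_le_nhds)
  rw [setIntegral_eq_of_eq_indicator measurableSet_Ioo measurableSet_Ioi hsub hind, integral_neg,
    ← integral_Ioc_eq_integral_Ioo, ← intervalIntegral.integral_of_le zero_le_one, hftc,
    legendreMellinPrimitive_one, sub_zero]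

theorem multiplier_kerSzero_recurrence {ν s : ℂ} (hs2 : s + 2 ∈ halfSzero ν) :
    s * (s + 1) * multiplier (kerSzero ν) s =
      (s - ν) * (s + ν + 1) * multiplier (kerSzero ν) (s + 2) := by
  have hk := (mellinAdmissible_kerSzero (mem_halfSzero_of_re_le hs2
    (by simp : s.re ≤ (s + 2).re))).mellinConvergent
  have hk2 := (mellinAdmissible_kerSzero hs2).mellinConvergent
  refine multiplier_recurrence_of_integral hk hk2 ?_
  set w : ℝ → ℂ := fun u ↦ s * (s + 1) * (u : ℂ) ^ (s - 1) -
    (s - ν) * (s + ν + 1) * (u : ℂ) ^ (s + 2 - 1)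
  have hind (u : ℝ) (_ : u ∈ Ioi 0) : w u * kerSzero ν u =
      (Ioi 1).indicator (fun u ↦ w u * deriv (legendreP ν) u) u := by
    simp only [kerSzero, indicator_apply, mem_Ioi, mul_ite, mul_zero]
  have hsub : Ioi (1 : ℝ) ⊆ Ioi 0 := Ioi_subset_Ioi zero_le_one
  have hint := (integrableOn_iff_of_eq_indicator measurableSet_Ioi measurableSet_Ioi hsub hind).1
    (integrableOn_and_integral_sub_cpow_mul hk hk2 _ _).1
  rw [setIntegral_eq_of_eq_indicator measurableSet_Ioi measurableSet_Ioi hsub hind,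
    integral_Ioi_of_hasDerivAt_of_tendsto' (fun u hu ↦ hasDerivAt_legendreMellinPrimitive ν s
      (one_pos.trans_le hu)) hint (tendsto_legendreMellinPrimitive_atTop hs2),
    legendreMellinPrimitive_one, zero_sub]

theorem mem_halfPminus_of_re_le {ν s t : ℂ} (hs : s ∈ halfPminus ν) (h : s.re ≤ t.re) :
    t ∈ halfPminus ν :=
  hs.trans_le h

theorem multiplier_kerPminus_recurrence {ν s : ℂ} (hs : s ∈ halfPminus ν) :
    (s - ν) * (s + ν + 1) * multiplier (kerPminus ν) s =
      s * (s + 1) * multiplier (kerPminus ν) (s + 2) := by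
  have hadd : 1 - (s + 2) + 2 = 1 - s := by ring
  have hrec := multiplier_kerSzero_recurrence (ν := ν) (s := 1 - (s + 2))
    (by rw [hadd]; exact one_sub_mem_halfSzero_iff.2 hs)
  rw [hadd, ← multiplier_transposeKernel, ← multiplier_transposeKernel,
    ← kerPminus_eq_transposeKernel] at hrec
  linear_combination -hrec

/-! ### Evaluation of the multipliers -/

theorem tendsto_mellin_add_natCast {k : ℝ → ℂ} {s : ℂ} (hs : MellinConvergent k s)
    (hk : ∀ u : ℝ, 1 ≤ u → k u = 0) :
    Tendsto (fun n : ℕ ↦ mellin k (s + n)) atTop (𝓝 0) := by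
  have hsplit (n : ℕ) : mellin k (s + n) =
      ∫ u in Ioi (0 : ℝ), (u : ℂ) ^ n * ((u : ℂ) ^ (s - 1) • k u) := by
    refine setIntegral_congr_fun measurableSet_Ioi fun u hu ↦ ?_
    have huc : (u : ℂ) ≠ 0 := Complex.ofReal_ne_zero.2 (ne_of_gt hu)
    simp only [smul_eq_mul]
    rw [add_sub_right_comm, Complex.cpow_add _ _ huc, Complex.cpow_natCast, mul_right_comm,
      mul_comm]
  simp only [hsplit]
  rw [← integral_zero ℝ ℂ (μ := volume.restrict (Ioi 0))]
  refine tendsto_integral_of_dominated_convergence (fun u ↦ ‖(u : ℂ) ^ (s - 1) • k u‖)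
    (fun n ↦ ((Complex.continuous_ofReal.pow n).aestronglyMeasurable).mul
      (Integrable.aestronglyMeasurable hs)) (Integrable.norm hs) (fun n ↦ ?_) ?_
  · filter_upwards [self_mem_ae_restrict measurableSet_Ioi] with u (hu : 0 < u)
    obtain hu1 | hu1 := le_or_gt 1 u
    · rw [hk u hu1, smul_zero, mul_zero]
    · rw [norm_mul, norm_pow, Complex.norm_of_nonneg hu.le]
      exact mul_le_of_le_one_left (norm_nonneg _) (pow_le_one₀ hu.le hu1.le)
  · filter_upwards [self_mem_ae_restrict measurableSet_Ioi] with u (hu : 0 < u)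
    obtain hu1 | hu1 := le_or_gt 1 u
    · simp only [hk u hu1, smul_zero, mul_zero, tendsto_const_nhds_iff]
    · have hpow : Tendsto (fun n : ℕ ↦ (u : ℂ) ^ n) atTop (𝓝 0) :=
        tendsto_pow_atTop_nhds_zero_of_norm_lt_one (by rwa [Complex.norm_of_nonneg hu.le])
      simpa only [zero_mul] using hpow.mul_const ((u : ℂ) ^ (s - 1) • k u)

theorem multiplier_eq_Gamma_ratio_of_recurrence {k : ℝ → ℂ} {s a b x y : ℂ}
    (hs : MellinConvergent k s) (hk : ∀ u : ℝ, 1 ≤ u → k u = 0) (h : a + b = x + y)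
    (hx : 0 < x.re) (hy : 0 < y.re)
    (hrec : ∀ n : ℕ, (x + n) * (y + n) * multiplier k (s + 2 * n) =
      (a + n) * (b + n) * multiplier k (s + 2 * n + 2)) :
    multiplier k s =
      Complex.Gamma x * Complex.Gamma y / (Complex.Gamma a * Complex.Gamma b) := by
  have hne {z : ℂ} (hz : 0 < z.re) (n : ℕ) : z + n ≠ 0 := fun h0 ↦ by
    have hre := congrArg Complex.re h0
    rw [Complex.add_re, Complex.natCast_re, Complex.zero_re] at hre
    exact (add_pos_of_pos_of_nonneg hz n.cast_nonneg).ne' hre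
  have hlim : Tendsto (fun n : ℕ ↦ multiplier k (s + 2 * n)) atTop (𝓝 1) := by
    have hzero := ((tendsto_mellin_add_natCast hs hk).comp
      (tendsto_id.const_mul_atTop' two_pos)).const_add 1
    simpa [Function.comp_def, multiplier] using hzero
  have hstep (n : ℕ) : s + 2 * n + 2 = s + 2 * (n + 1 : ℕ) := by
    push_cast
    ring
  have hG := eq_Gamma_ratio_of_recurrence h (fun n ↦ mul_ne_zero (hne hx n) (hne hy n))
    (fun n ↦ by rw [hrec n, hstep]) hlim
  rwa [Nat.cast_zero, mul_zero, add_zero] at hG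

theorem multiplier_kerSminus (ν : ℂ) {s : ℂ} (hs : s ∈ halfSminus) :
    multiplier (kerSminus ν) s = gammaSminus ν s := by
  have hs0 : 0 < s.re := hs
  refine multiplier_eq_Gamma_ratio_of_recurrence
    (mellinAdmissible_kerSminus ν hs).mellinConvergent
    (fun u hu ↦ if_neg fun h ↦ hu.not_gt h.2) (by ring) (by simpa using hs0) ?_ fun n ↦ ?_
  · rw [Complex.add_re, Complex.div_ofNat_re, Complex.div_ofNat_re, Complex.one_re]
    linarith
  · have hrec := multiplier_kerSminus_recurrence ν (s := s + 2 * n)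
      (mem_halfSminus_of_re_le hs (by simp))
    linear_combination hrec / 4

theorem multiplier_kerPminus {ν s : ℂ} (hs : s ∈ halfPminus ν) :
    multiplier (kerPminus ν) s = gammaPminus ν s := by
  obtain ⟨hs1, hs2⟩ := max_lt_iff.1 (mem_ofPred.1 hs)
  refine multiplier_eq_Gamma_ratio_of_recurrence
    (mellinAdmissible_kerPminus hs).mellinConvergent
    (fun u hu ↦ if_neg fun h ↦ hu.not_gt h.2) (by ring) ?_ ?_ fun n ↦ ?_
  · simp only [Complex.add_re, Complex.div_ofNat_re, Complex.one_re]
    linarith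
  · simp only [Complex.sub_re, Complex.div_ofNat_re]
    linarith
  · have hrec := multiplier_kerPminus_recurrence (s := s + 2 * n)
      (mem_halfPminus_of_re_le hs (by simp))
    linear_combination hrec / 4

theorem gammaPminus_eq_gammaSzero_one_sub (ν s : ℂ) :
    gammaPminus ν s = gammaSzero ν (1 - s) := by
  rw [gammaPminus, gammaSzero]
  ring_nf

theorem gammaPzero_eq_gammaSminus_one_sub (ν s : ℂ) :
    gammaPzero ν s = gammaSminus ν (1 - s) := by
  rw [gammaPzero, gammaSminus]
  ring_nf

theorem multiplier_kerPminus_eq_one_sub (ν s : ℂ) :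
    multiplier (kerPminus ν) s = multiplier (kerSzero ν) (1 - s) := by
  rw [kerPminus_eq_transposeKernel, multiplier_transposeKernel]

theorem multiplier_kerPzero_eq_one_sub (ν s : ℂ) :
    multiplier (kerPzero ν) s = multiplier (kerSminus ν) (1 - s) := by
  rw [kerPzero_eq_transposeKernel, multiplier_transposeKernel]

theorem multiplier_kerSzero {ν s : ℂ} (hs : s ∈ halfSzero ν) :
    multiplier (kerSzero ν) s = gammaSzero ν s := by
  have hs' : 1 - s ∈ halfPminus ν := one_sub_mem_halfSzero_iff.1 (by rwa [sub_sub_cancel])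
  have h := multiplier_kerPminus hs'
  rwa [multiplier_kerPminus_eq_one_sub, gammaPminus_eq_gammaSzero_one_sub, sub_sub_cancel] at h

theorem multiplier_kerPzero (ν : ℂ) {s : ℂ} (hs : s ∈ halfPzero) :
    multiplier (kerPzero ν) s = gammaPzero ν s := by
  rw [multiplier_kerPzero_eq_one_sub, gammaPzero_eq_gammaSminus_one_sub,
    multiplier_kerSminus ν (one_sub_mem_halfSminus_iff.2 hs)]

/-! ### Relations between the multipliers -/

theorem gammaPzero_eq_one_div (ν s : ℂ) : gammaPzero ν s = 1 / gammaSzero ν s := by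
  rw [gammaPzero, gammaSzero, one_div_div]

theorem gammaPminus_eq_one_div (ν s : ℂ) : gammaPminus ν s = 1 / gammaSminus ν s := by
  rw [gammaPminus, gammaSminus, one_div_div]

theorem gammaSzero_eq_duplication (ν s : ℂ) :
    gammaSzero ν s = (2 : ℂ) ^ (-s) / ((√Real.pi : ℝ) : ℂ) *
      (Complex.Gamma (-s / 2 - ν / 2 + 1 / 2) * Complex.Gamma (-s / 2 + ν / 2 + 1) /
        Complex.Gamma (1 - s)) := by
  have h := Complex.Gamma_mul_Gamma_add_half (1 / 2 - s / 2)
  rw [show 1 / 2 - s / 2 + 1 / 2 = 1 - s / 2 by ring, show 2 * (1 / 2 - s / 2) = 1 - s by ring,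
    sub_sub_cancel] at h
  rw [gammaSzero, h, Complex.cpow_neg]
  simp only [div_eq_mul_inv, mul_inv]
  ring

theorem gammaSzero_ne_zero {ν s : ℂ} (hs : s ∈ halfSzero ν) (hs' : s ∈ halfPzero) :
    gammaSzero ν s ≠ 0 := by
  obtain ⟨h1, h2⟩ := lt_min_iff.1 (mem_ofPred.1 hs)
  have h3 : s.re < 1 := hs'
  refine div_ne_zero (mul_ne_zero ?_ ?_) (mul_ne_zero ?_ ?_) <;>
  · refine Complex.Gamma_ne_zero_of_re_pos ?_
    simp only [Complex.add_re, Complex.sub_re, Complex.neg_re, Complex.div_ofNat_re,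
      Complex.one_re]
    linarith

theorem gammaSminus_ne_zero {ν s : ℂ} (hs : s ∈ halfSminus) (hs' : s ∈ halfPminus ν) :
    gammaSminus ν s ≠ 0 := by
  obtain ⟨h1, h2⟩ := max_lt_iff.1 (mem_ofPred.1 hs')
  have h3 : 0 < s.re := hs
  refine div_ne_zero (mul_ne_zero ?_ ?_) (mul_ne_zero ?_ ?_) <;>
  · refine Complex.Gamma_ne_zero_of_re_pos ?_
    simp only [Complex.add_re, Complex.sub_re, Complex.div_ofNat_re, Complex.one_re]
    linarith

theorem multiplier_kerPzero_eq_one_div {ν s : ℂ} (hs : s ∈ halfPzero ∩ halfSzero ν) :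
    multiplier (kerSzero ν) s ≠ 0 ∧
      multiplier (kerPzero ν) s = 1 / multiplier (kerSzero ν) s := by
  rw [multiplier_kerSzero hs.2, multiplier_kerPzero ν hs.1]
  exact ⟨gammaSzero_ne_zero hs.2 hs.1, gammaPzero_eq_one_div ν s⟩

theorem multiplier_kerPminus_eq_one_div {ν s : ℂ} (hs : s ∈ halfPminus ν ∩ halfSminus) :
    multiplier (kerSminus ν) s ≠ 0 ∧
      multiplier (kerPminus ν) s = 1 / multiplier (kerSminus ν) s := by
  rw [multiplier_kerSminus ν hs.2, multiplier_kerPminus hs.1]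
  exact ⟨gammaSminus_ne_zero hs.2 hs.1, gammaPminus_eq_one_div ν s⟩

theorem meromorphic_Gamma_comp_affine (a b : ℂ) :
    Meromorphic fun s : ℂ ↦ Complex.Gamma (a * s + b) := fun _ ↦
  (Meromorphic.Gamma _).comp_analyticAt (f := Complex.Gamma) (g := fun s : ℂ ↦ a * s + b)
    (by fun_prop)

theorem meromorphic_gammaSzero (ν : ℂ) : Meromorphic (gammaSzero ν) := by
  have h := ((meromorphic_Gamma_comp_affine (-1 / 2) (ν / 2 + 1)).mul
    (meromorphic_Gamma_comp_affine (-1 / 2) (-ν / 2 + 1 / 2))).div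
    ((meromorphic_Gamma_comp_affine (-1 / 2) (1 / 2)).mul
      (meromorphic_Gamma_comp_affine (-1 / 2) 1))
  convert! h using 1
  funext s
  simp only [gammaSzero, Pi.mul_apply, Pi.div_apply]
  ring_nf

theorem meromorphic_gammaSminus (ν : ℂ) : Meromorphic (gammaSminus ν) := by
  have h := ((meromorphic_Gamma_comp_affine (1 / 2) 0).mul
    (meromorphic_Gamma_comp_affine (1 / 2) (1 / 2))).div
    ((meromorphic_Gamma_comp_affine (1 / 2) (ν / 2 + 1 / 2)).mul
      (meromorphic_Gamma_comp_affine (1 / 2) (-ν / 2)))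
  convert! h using 1
  funext s
  simp only [gammaSminus, Pi.mul_apply, Pi.div_apply]
  ring_nf

theorem meromorphic_gammaPzero (ν : ℂ) : Meromorphic (gammaPzero ν) := by
  have h : gammaPzero ν = (gammaSzero ν)⁻¹ :=
    funext fun s ↦ (gammaPzero_eq_one_div ν s).trans (one_div _)
  rw [h]
  exact (meromorphic_gammaSzero ν).inv

theorem meromorphic_gammaPminus (ν : ℂ) : Meromorphic (gammaPminus ν) := by
  have h : gammaPminus ν = (gammaSminus ν)⁻¹ :=
    funext fun s ↦ (gammaPminus_eq_one_div ν s).trans (one_div _)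
  rw [h]
  exact (meromorphic_gammaSminus ν).inv

end BuschmanErdelyi

theorem theorem17 (ν : ℂ) :
    -- the operators are Mellin convolutions
    (BuschmanErdelyi.ActsAsMellinConvolution (BuschmanErdelyi.opSzero ν)
        (BuschmanErdelyi.domSzero ν) (BuschmanErdelyi.kerSzero ν) (BuschmanErdelyi.halfSzero ν) ∧
      BuschmanErdelyi.ActsAsMellinConvolution (BuschmanErdelyi.opPzero ν)
        (BuschmanErdelyi.domPzero ν) (BuschmanErdelyi.kerPzero ν) BuschmanErdelyi.halfPzero ∧
      BuschmanErdelyi.ActsAsMellinConvolution (BuschmanErdelyi.opPminus ν)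
        (BuschmanErdelyi.domPminus ν) (BuschmanErdelyi.kerPminus ν)
        (BuschmanErdelyi.halfPminus ν) ∧
      BuschmanErdelyi.ActsAsMellinConvolution (BuschmanErdelyi.opSminus ν)
        (BuschmanErdelyi.domSminus ν) (BuschmanErdelyi.kerSminus ν) BuschmanErdelyi.halfSminus) ∧
    -- the derivatives in the definitions of the operators S exist almost everywhere
    ((∀ s ∈ BuschmanErdelyi.halfSzero ν, ∀ f ∈ BuschmanErdelyi.domSzero ν, MellinConvergent f s →
        ∀ᵐ x ∂(volume.restrict (Ioi (0 : ℝ))), DifferentiableAt ℝ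
          (fun z : ℝ => ∫ t in Ioc 0 z, BuschmanErdelyi.legendreP ν (z / t) * f t) x) ∧
      (∀ s ∈ BuschmanErdelyi.halfSminus, ∀ f ∈ BuschmanErdelyi.domSminus ν, MellinConvergent f s →
        ∀ᵐ x ∂(volume.restrict (Ioi (0 : ℝ))), DifferentiableAt ℝ
          (fun z : ℝ => ∫ t in Ioi z, BuschmanErdelyi.legendreP ν (z / t) * f t) x)) ∧
    -- the multipliers
    ((∀ s ∈ BuschmanErdelyi.halfSzero ν,
        BuschmanErdelyi.multiplier (BuschmanErdelyi.kerSzero ν) s =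
          BuschmanErdelyi.gammaSzero ν s ∧
        BuschmanErdelyi.multiplier (BuschmanErdelyi.kerSzero ν) s =
          (2 : ℂ) ^ (-s) / ((√Real.pi : ℝ) : ℂ) *
            (Complex.Gamma (-s / 2 - ν / 2 + 1 / 2) * Complex.Gamma (-s / 2 + ν / 2 + 1) /
              Complex.Gamma (1 - s))) ∧
      (∀ s ∈ BuschmanErdelyi.halfPzero,
        BuschmanErdelyi.multiplier (BuschmanErdelyi.kerPzero ν) s =
          BuschmanErdelyi.gammaPzero ν s) ∧
      (∀ s ∈ BuschmanErdelyi.halfPminus ν,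
        BuschmanErdelyi.multiplier (BuschmanErdelyi.kerPminus ν) s =
          BuschmanErdelyi.gammaPminus ν s) ∧
      (∀ s ∈ BuschmanErdelyi.halfSminus,
        BuschmanErdelyi.multiplier (BuschmanErdelyi.kerSminus ν) s =
          BuschmanErdelyi.gammaSminus ν s)) ∧
    -- reciprocity, on the common half-planes; both sides are nonzero there
    ((∀ s ∈ BuschmanErdelyi.halfPzero ∩ BuschmanErdelyi.halfSzero ν,
        BuschmanErdelyi.multiplier (BuschmanErdelyi.kerSzero ν) s ≠ 0 ∧
        BuschmanErdelyi.multiplier (BuschmanErdelyi.kerPzero ν) s =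
          1 / BuschmanErdelyi.multiplier (BuschmanErdelyi.kerSzero ν) s) ∧
      (∀ s ∈ BuschmanErdelyi.halfPminus ν ∩ BuschmanErdelyi.halfSminus,
        BuschmanErdelyi.multiplier (BuschmanErdelyi.kerSminus ν) s ≠ 0 ∧
        BuschmanErdelyi.multiplier (BuschmanErdelyi.kerPminus ν) s =
          1 / BuschmanErdelyi.multiplier (BuschmanErdelyi.kerSminus ν) s)) ∧
    -- reflection
    ((∀ s ∈ BuschmanErdelyi.halfPminus ν, 1 - s ∈ BuschmanErdelyi.halfSzero ν ∧
        BuschmanErdelyi.multiplier (BuschmanErdelyi.kerPminus ν) s =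
          BuschmanErdelyi.multiplier (BuschmanErdelyi.kerSzero ν) (1 - s)) ∧
      (∀ s ∈ BuschmanErdelyi.halfPzero, 1 - s ∈ BuschmanErdelyi.halfSminus ∧
        BuschmanErdelyi.multiplier (BuschmanErdelyi.kerPzero ν) s =
          BuschmanErdelyi.multiplier (BuschmanErdelyi.kerSminus ν) (1 - s))) ∧
    -- both kinds of relations for the meromorphic continuations to the whole plane
    ((Meromorphic (BuschmanErdelyi.gammaSzero ν) ∧ Meromorphic (BuschmanErdelyi.gammaPzero ν) ∧
        Meromorphic (BuschmanErdelyi.gammaPminus ν) ∧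
        Meromorphic (BuschmanErdelyi.gammaSminus ν)) ∧
      ∀ s : ℂ,
        BuschmanErdelyi.gammaPzero ν s = 1 / BuschmanErdelyi.gammaSzero ν s ∧
        BuschmanErdelyi.gammaPminus ν s = 1 / BuschmanErdelyi.gammaSminus ν s ∧
        BuschmanErdelyi.gammaPminus ν s = BuschmanErdelyi.gammaSzero ν (1 - s) ∧
        BuschmanErdelyi.gammaPzero ν s = BuschmanErdelyi.gammaSminus ν (1 - s)) := by
  open BuschmanErdelyi in
  exact ⟨⟨actsAsMellinConvolution_opSzero ν, actsAsMellinConvolution_opPzero ν,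
      actsAsMellinConvolution_opPminus ν, actsAsMellinConvolution_opSminus ν⟩,
    ⟨fun _ hs _ hfD hf ↦ (ae_hasDerivAt_integral_opSzero hs hfD hf).mono
        fun _ hx ↦ hx.differentiableAt,
      fun _ hs _ hfD hf ↦ (ae_hasDerivAt_integral_opSminus hs hfD hf).mono
        fun _ hx ↦ hx.differentiableAt⟩,
    ⟨fun s hs ↦ ⟨multiplier_kerSzero hs,
        (multiplier_kerSzero hs).trans (gammaSzero_eq_duplication ν s)⟩,
      fun _ hs ↦ multiplier_kerPzero ν hs, fun _ hs ↦ multiplier_kerPminus hs,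
      fun _ hs ↦ multiplier_kerSminus ν hs⟩,
    ⟨fun _ hs ↦ multiplier_kerPzero_eq_one_div hs,
      fun _ hs ↦ multiplier_kerPminus_eq_one_div hs⟩,
    ⟨fun s hs ↦ ⟨one_sub_mem_halfSzero_iff.2 hs, multiplier_kerPminus_eq_one_sub ν s⟩,
      fun s hs ↦ ⟨one_sub_mem_halfSminus_iff.2 hs, multiplier_kerPzero_eq_one_sub ν s⟩⟩,
    ⟨meromorphic_gammaSzero ν, meromorphic_gammaPzero ν, meromorphic_gammaPminus ν,
      meromorphic_gammaSminus ν⟩,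
    fun s ↦ ⟨gammaPzero_eq_one_div ν s, gammaPminus_eq_one_div ν s,
      gammaPminus_eq_gammaSzero_one_sub ν s, gammaPzero_eq_gammaSminus_one_sub ν s⟩⟩
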